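/- Let $c\colon\mathbf R^2\to\mathbf R$ be smooth, everywhere positive, and constant for sufficiently large $|x|$; put $c_0=c(0)$. Let $V\colon\mathbf R^2\to\mathbf R$ be smooth with $|V^{(\alpha)}(y)|\le C_\alpha(1+|y|)^{-|\alpha|-\varkappa}$ for all multi-indices $\alpha$, for some $\varkappa>1$. Let $g_0\colon[0,\infty)\to\mathbf R$ be smooth with $g_0(0)=0$, $\int_0^\infty g_0(\tau)\,d\tau=1$, and $|g_0^{(k)}(\tau)|\le C_ke^{-\nu\tau}$ for all $k\ge0$ and $\tau\ge 0$, for some $\nu>0$. For $\lambda,\mu>0$ put $$g(\tau)=\lambda g_0(\lambda\tau),\qquad v(x)=V(x/\mu),\qquad \omega=\frac{c_0}{\lambda\mu}.$$ Let $L=-\langle\nabla,c^2\nabla\rangle$ be the operator on $L^2(\mathbf R^2)$ with domain $W_2^2(\mathbf R^2)$, and let $D=\sqrt L$. For $\xi\in\mathbf R$ and $t\ge0$ let $$\widetilde g(\xi)=\frac1{\sqrt{2\pi}}\int_0^\infty e^{-i\xi\tau}g(\tau)\,d\tau,\qquad G(\xi,t)=\int_0^\infty e^{-i\xi\tau}g(\tau+t)\,d\tau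 .$$ For the Cauchy problem $\eta''+L\eta=g'(t)v$, $\eta|_{t=0}=\eta_t|_{t=0}=0$, the propagating and transient components are defined by $$\eta_{prop}(t)=\sqrt{2\pi}\,\operatorname{Re}\bigl(e^{iDt}\widetilde g(D)\bigr)v,\qquad \eta_{trans}(t)=-\operatorname{Re}\bigl(G(D,t)\bigr)v,\qquad t\ge0,$$ where functions of $D$ are understood in the sense of the functional calculus for self-adjoint operators and $\operatorname{Re}A=\frac12(A+A^*)$. Let $\|\cdot\|$ be the norm of $L^2(\mathbf R^2)$ and $\|\cdot\|_1$ that of the Sobolev space $H^1(\mathbf R^2)$. Then $L$ (with domain exactly $W_2^2(\mathbf R^2)$) is a nonnegative self-adjoint operator, so that $\eta_{prop}$ and $\eta_{trans}$ are well defined. For all sufficiently small $\mu>0$, all $\lambda>0$, and all $t\ge0$, $\eta_{prop}(t)$ and $\eta_{trans}(t)$ belong to $H^1(\mathbf R^2)$, both functions are differentiable in $t\in[0,\infty)$ with values in $L^2(\mathbf R^2)$ (one-sidedly at $t=0$), and, as $\mu\to0$, $$\|\eta_{prop}(t)\|_1=O(1),\qquad \|\eta_{prop}'(t)\|=O(1),$$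 $$\|\eta_{trans}(t)\|_1=O(e^{-\nu\lambda t}),\qquad \|\eta_{trans}'(t)\|=O(\omega^{-1}e^{-\nu\lambda t}),$$ where the constants in the $O$-estimates depend only on $c$, $V$, $g_0$, and $\nu$; in particular, the estimates are uniform in $\lambda>0$ and $t\ge0$. -/

import Mathlib

open MeasureTheory Set
open scoped ContDiff LineDeriv ComplexStarModule

noncomputable section

/-- The Euclidean plane. -/
abbrev Plane : Type := EuclideanSpace ℝ (Fin 2)

/-- The complex Hilbert space `L²(ℝ²)`. -/
abbrev PlaneL2 : Type := Lp ℂ 2 (volume : Measure Plane)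

/-! ### The data of the problem -/

/-- An admissible velocity: smooth, everywhere positive, constant for large `|x|`. -/
structure IsVelocity (c : Plane → ℝ) : Prop where
  smooth : ContDiff ℝ ∞ c
  pos : ∀ x, 0 < c x
  stabilizes : ∃ R cinf : ℝ, ∀ x, R < ‖x‖ → c x = cinf

/-- A spatial profile: smooth, each derivative of order `n` being `O((1 + |y|)^(-n - ϰ))`. -/
structure IsSpatialProfile (V : Plane → ℝ) (ϰ : ℝ) : Prop where
  smooth : ContDiff ℝ ∞ V
  decay : ∀ n : ℕ, ∃ C : ℝ, ∀ y,
    ‖iteratedFDeriv ℝ n V y‖ ≤ C * (1 + ‖y‖) ^ (-(n : ℝ) - ϰ)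

/-- A time profile: a smooth function on `[0, ∞)` (only its values there matter) that vanishes
at `0`, has integral `1`, and decays like `exp (-ν τ)` together with all derivatives. -/
structure IsTimeProfile (g₀ : ℝ → ℝ) (ν : ℝ) : Prop where
  smooth : ContDiffOn ℝ ∞ g₀ (Ici 0)
  zero : g₀ 0 = 0
  integral : ∫ τ in Ioi (0 : ℝ), g₀ τ = 1
  decay : ∀ k : ℕ, ∃ C : ℝ, ∀ τ, 0 ≤ τ →
    |iteratedDerivWithin k g₀ (Ici 0) τ| ≤ C * Real.exp (-ν * τ)

/-- The scaled profile `x ↦ V(x/μ)` is square integrable. -/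
theorem IsSpatialProfile.memLp {V : Plane → ℝ} {ϰ : ℝ} (hV : IsSpatialProfile V ϰ)
    (hϰ : 1 < ϰ) {μ : ℝ} (hμ : 0 < μ) :
    MemLp (fun x : Plane => (V (μ⁻¹ • x) : ℂ)) 2 volume := by
  obtain ⟨C, hC⟩ := hV.decay 0
  have hcont : Continuous V := hV.smooth.continuous
  have hdom : Integrable (fun y : Plane => C ^ 2 * (1 + ‖y‖) ^ (-(2 * ϰ))) volume :=
    (integrable_one_add_norm (by simp; linarith)).const_mul _
  have hint : Integrable (fun y : Plane => V y ^ 2) volume := by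
    refine hdom.mono' (hcont.pow 2).aestronglyMeasurable (Filter.Eventually.of_forall fun y => ?_)
    have h1 : |V y| ≤ C * (1 + ‖y‖) ^ (-ϰ) := by simpa using hC y
    have hp : (0 : ℝ) < 1 + ‖y‖ := by positivity
    have h2 : ((1 + ‖y‖) ^ (-ϰ)) ^ 2 = (1 + ‖y‖) ^ (-(2 * ϰ)) := by
      rw [← Real.rpow_natCast, ← Real.rpow_mul hp.le]
      congr 1
      push_cast
      ring
    rw [Real.norm_eq_abs, abs_pow, ← h2, ← mul_pow]
    exact pow_le_pow_left₀ (abs_nonneg _) h1 2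
  have hint' : Integrable (fun x : Plane => V (μ⁻¹ • x) ^ 2) volume :=
    hint.comp_smul (inv_ne_zero hμ.ne')
  have hm : MemLp (fun x : Plane => V (μ⁻¹ • x)) 2 volume :=
    (memLp_two_iff_integrable_sq
      (hcont.comp (continuous_const_smul _)).aestronglyMeasurable).2 hint'
  exact hm.ofReal

/-- The element `v = V(·/μ)` of `L²(ℝ²)`. -/
def sourceL2 {V : Plane → ℝ} {ϰ : ℝ} (hV : IsSpatialProfile V ϰ) (hϰ : 1 < ϰ)
    {μ : ℝ} (hμ : 0 < μ) : PlaneL2 :=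
  (hV.memLp hϰ hμ).toLp _

/-! ### Derivatives and the first Sobolev norm -/

/-- The distributional derivative `∂/∂x_i` of a tempered distribution on the plane. -/
def distPartial (i : Fin 2) (T : TemperedDistribution Plane ℂ) : TemperedDistribution Plane ℂ :=
  ∂_{(EuclideanSpace.single i (1 : ℝ) : Plane)} T

open Classical in
/-- The weak derivative `∂u/∂x_i` in `L²`, for those `u` for which it exists there
(and `0` otherwise). -/
def weakPartial (i : Fin 2) (u : PlaneL2) : PlaneL2 :=
  if h : ∃ w : PlaneL2, distPartial i (u : TemperedDistribution Plane ℂ) = w then h.choose else 0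

/-- Membership in the Sobolev space `H^s = W_2^s(ℝ²)`. -/
def InSobolev (s : ℝ) (u : PlaneL2) : Prop :=
  TemperedDistribution.MemSobolev s 2 (u : TemperedDistribution Plane ℂ)

/-- The norm `‖u‖₁` of the Sobolev space `H¹`, to be used for `u` with `InSobolev 1 u`. -/
def sobolevNormOne (u : PlaneL2) : ℝ :=
  Real.sqrt (‖u‖ ^ 2 + ∑ i : Fin 2, ‖weakPartial i u‖ ^ 2)

/-! ### The operator `L` and functions of `D = √L` -/

/-- The divergence-form expression `-∑ ∂_i (c² ∂_i u)` in the sense of distributions. -/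
def divForm (c : Plane → ℝ) (T : TemperedDistribution Plane ℂ) : TemperedDistribution Plane ℂ :=
  -∑ i : Fin 2, distPartial i
    (TemperedDistribution.smulLeftCLM ℂ (fun x => ((c x ^ 2 : ℝ) : ℂ)) (distPartial i T))

/-- Additivity of the distributional derivative. -/
theorem distPartial_add (i : Fin 2) (S T : TemperedDistribution Plane ℂ) :
    distPartial i (S + T) = distPartial i S + distPartial i T :=
  LineDeriv.lineDerivOp_add _ _ _

/-- Homogeneity of the distributional derivative. -/
theorem distPartial_smul (i : Fin 2) (a : ℂ) (T : TemperedDistribution Plane ℂ) :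
    distPartial i (a • T) = a • distPartial i T :=
  LineDeriv.lineDerivOp_smul _ _ _

/-- Additivity of the divergence-form expression. -/
theorem divForm_add (c : Plane → ℝ) (S T : TemperedDistribution Plane ℂ) :
    divForm c (S + T) = divForm c S + divForm c T := by
  simp only [divForm, distPartial_add, map_add, Finset.sum_add_distrib, neg_add]

/-- Homogeneity of the divergence-form expression. -/
theorem divForm_smul (c : Plane → ℝ) (a : ℂ) (T : TemperedDistribution Plane ℂ) :
    divForm c (a • T) = a • divForm c T := by
  simp only [divForm, distPartial_smul, map_smul, ← Finset.smul_sum, smul_neg]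

/-- The graph of the operator `L` in `L²(ℝ²)` with domain `W_2^2(ℝ²)`: the pairs `(u, f)`
with `u ∈ W_2^2` and `f = -∑ ∂_i (c² ∂_i u)`. -/
def waveGraph (c : Plane → ℝ) : Submodule ℂ (PlaneL2 × PlaneL2) where
  carrier := {p | InSobolev 2 p.1 ∧
    (p.2 : TemperedDistribution Plane ℂ) = divForm c (p.1 : TemperedDistribution Plane ℂ)}
  zero_mem' := by
    have h0 : ((0 : PlaneL2) : TemperedDistribution Plane ℂ) = 0 := by
      rw [← Lp.toTemperedDistributionCLM_apply, map_zero]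
    have hd : divForm c (0 : TemperedDistribution Plane ℂ) = 0 := by
      have h := divForm_add c 0 0
      rw [add_zero] at h
      exact left_eq_add.1 h
    refine ⟨?_, ?_⟩
    · change TemperedDistribution.MemSobolev 2 2 ((0 : PlaneL2) : TemperedDistribution Plane ℂ)
      rw [h0]
      exact TemperedDistribution.memSobolev_fun_zero Plane ℂ 2 2
    · change ((0 : PlaneL2) : TemperedDistribution Plane ℂ) =
        divForm c ((0 : PlaneL2) : TemperedDistribution Plane ℂ)
      rw [h0, hd]
  add_mem' := by
    rintro ⟨u, f⟩ ⟨w, k⟩ ⟨hu, hf⟩ ⟨hw, hk⟩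
    have hadd : ∀ a b : PlaneL2, ((a + b : PlaneL2) : TemperedDistribution Plane ℂ) = a + b := by
      intro a b
      simp only [← Lp.toTemperedDistributionCLM_apply, map_add]
    refine ⟨?_, ?_⟩
    · change TemperedDistribution.MemSobolev 2 2 ((u + w : PlaneL2) : TemperedDistribution Plane ℂ)
      rw [hadd]
      exact hu.add hw
    · change ((f + k : PlaneL2) : TemperedDistribution Plane ℂ) =
        divForm c ((u + w : PlaneL2) : TemperedDistribution Plane ℂ)
      rw [hadd, hadd, divForm_add]
      exact congrArg₂ (· + ·) hf hk
  smul_mem' := by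
    rintro a ⟨u, f⟩ ⟨hu, hf⟩
    have hsm : ∀ b : PlaneL2, ((a • b : PlaneL2) : TemperedDistribution Plane ℂ)
        = a • (b : TemperedDistribution Plane ℂ) := by
      intro b
      simp only [← Lp.toTemperedDistributionCLM_apply, map_smul]
    refine ⟨?_, ?_⟩
    · change TemperedDistribution.MemSobolev 2 2 ((a • u : PlaneL2) : TemperedDistribution Plane ℂ)
      rw [hsm]
      exact hu.smul a
    · change ((a • f : PlaneL2) : TemperedDistribution Plane ℂ) =
        divForm c ((a • u : PlaneL2) : TemperedDistribution Plane ℂ)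
      rw [hsm, hsm, divForm_smul]
      exact congrArg (a • ·) hf

/-- The spatial part `L u = -⟨∇, c² ∇⟩ u` of the wave operator, as an unbounded operator in
`L²(ℝ²)` with domain `W_2^2(ℝ²)`. -/
def waveOp (c : Plane → ℝ) : PlaneL2 →ₗ.[ℂ] PlaneL2 :=
  (waveGraph c).toLinearPMap

section FunctionalCalculus

variable {H : Type*} [NormedAddCommGroup H] [InnerProductSpace ℂ H] [CompleteSpace H]

/-- `R` is the bounded two-sided inverse of `1 + A : dom A → H`. -/
def IsInverseOneAdd (A : H →ₗ.[ℂ] H) (R : H →L[ℂ] H) : Prop :=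
  (∀ x : H, ∃ hx : R x ∈ A.domain, R x + A ⟨R x, hx⟩ = x) ∧
    ∀ u : A.domain, R ((u : H) + A u) = u

open Classical in
/-- The resolvent `(1 + A)⁻¹`; it exists for every nonnegative self-adjoint `A`
(and is set to `0` when it does not exist). -/
def invOneAdd (A : H →ₗ.[ℂ] H) : H →L[ℂ] H :=
  if h : ∃ R : H →L[ℂ] H, IsInverseOneAdd A R then h.choose else 0

/-- The functional calculus of a nonnegative self-adjoint operator `A`, for functions
`f : [0, ∞) → ℂ` continuous and tending to `0` at infinity. In terms of the resolvent
`R = (1 + A)⁻¹` one has `A = R⁻¹ - 1`, so `f(A)` is the function `r ↦ f(r⁻¹ - 1)` of the bounded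
self-adjoint operator `R`, whose spectrum lies in `[0, 1]`; the point `r = 0` corresponds to
infinity in the spectrum of `A`, and there the value is the limit `0` of `f`. -/
def opFunction (A : H →ₗ.[ℂ] H) (f : ℝ → ℂ) : H →L[ℂ] H :=
  cfc (fun z : ℂ => if z = 0 then 0 else f (z.re⁻¹ - 1)) (invOneAdd A)

end FunctionalCalculus

/-- The function `f(D)` of the positive square root `D = √L`. -/
def functionOfD (c : Plane → ℝ) (f : ℝ → ℂ) : PlaneL2 →L[ℂ] PlaneL2 :=
  opFunction (waveOp c) (fun s => f (Real.sqrt s))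

/-! ### The two components of the solution -/

/-- `g(τ) = λ g₀(λ τ)`. -/
def scaledTime (g₀ : ℝ → ℝ) (lam : ℝ) : ℝ → ℝ := fun τ => lam * g₀ (lam * τ)

/-- The unitary Fourier transform of `g` extended by zero to the negative half-line. -/
def fourierTilde (g : ℝ → ℝ) (ξ : ℝ) : ℂ :=
  ((Real.sqrt (2 * Real.pi))⁻¹ : ℝ) *
    ∫ τ in Ioi (0 : ℝ), Complex.exp (-Complex.I * ξ * τ) * (g τ : ℂ)

/-- The symbol `G(ξ, t)`, the integral over `τ > 0` of `exp(-i ξ τ) g(τ + t)`. -/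
def transSymbol (g : ℝ → ℝ) (ξ t : ℝ) : ℂ :=
  ∫ τ in Ioi (0 : ℝ), Complex.exp (-Complex.I * ξ * τ) * (g (τ + t) : ℂ)

/-- The propagating component `√(2π) Re(exp(i D t) g̃(D)) v`. -/
def etaProp (c : Plane → ℝ) (g : ℝ → ℝ) (v : PlaneL2) (t : ℝ) : PlaneL2 :=
  ((Real.sqrt (2 * Real.pi) : ℝ) : ℂ) •
    ((ℜ (functionOfD c fun ξ => Complex.exp (Complex.I * ξ * t) * fourierTilde g ξ) :
      selfAdjoint (PlaneL2 →L[ℂ] PlaneL2)) : PlaneL2 →L[ℂ] PlaneL2) v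

/-- The transient component `-Re(G(D, t)) v`, for `t ≥ 0`. -/
def etaTrans (c : Plane → ℝ) (g : ℝ → ℝ) (v : PlaneL2) (t : ℝ) : PlaneL2 :=
  -(((ℜ (functionOfD c fun ξ => transSymbol g ξ t) :
      selfAdjoint (PlaneL2 →L[ℂ] PlaneL2)) : PlaneL2 →L[ℂ] PlaneL2) v)

/-- The dimensionless ratio `ω = c(0) / (λ μ)`. -/
def omegaRatio (c : Plane → ℝ) (lam μ : ℝ) : ℝ := c 0 / (lam * μ)

end

/-!
Functions of `D = √L` are, by definition, functions of the resolvent `R = (1 + L)⁻¹`, so everything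
rests on a usable formula for `R`.

Let `K ⊆ L² ⊕ L² ⊕ L²` be the closed subspace of the triples `(u, c ∂₁u, c ∂₂u)`, `u ∈ H¹`, and
let `J : K → L²` be its first coordinate, an injective contraction. For `f ∈ L²` the vector
`u = J J* f` is the weak solution of `u + L u = f`. As the leading coefficient `c²` is a scalar, the
product rule expresses `Δu` through `f`, `u` and `∇u`, hence `u ∈ H²`; together with integration by
parts, proved on the Fourier side, this shows that `J J*` is the two-sided inverse of `1 + L` on
`H²` (`isInverseOneAdd_formResolvent`). Since `J J*` is self-adjoint with spectrum in `[0, 1]`, the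
operator `L` is self-adjoint and nonnegative with domain `H²`.

The norm of `K` is equivalent to that of `H¹`, and for `T = f(D)` three facts give all estimates:
* `‖T‖ ≤ sup |f|`;
* `T` leaves the range of `J` invariant and acts there with norm at most `sup |f|` in the norm of
  `K`, because `T` commutes with `R^(1/2)` and `‖R^(1/2) x‖ = ‖J* x‖`
  (`exists_cfc_formResolvent_apply_eq`);
* `‖T J k‖ ≤ C ‖k‖` if `|f(ξ)| ≤ C √(1 + ξ²)`, because `(T J)(T J)* = T R T*`
  (`norm_cfc_formResolvent_comp_le`).

The symbols are `exp(iξt) m(ξ/λ, 0)` and `m(ξ/λ, λt)`, where `m(η, s)` is the integral over `τ > 0`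
of `exp(-iητ) g₀(τ + s)`. The bound `|m(η, s)| ≤ C exp(-νs)` is uniform in `η`, and `m(η, 0)` is
`O(1/(1 + η²))` since `g₀(0) = 0`; second order Taylor estimates of the symbols, uniform in `ξ`,
make the components differentiable in `t` (`hasDerivWithinAt_cfc_formResolvent`). In two dimensions
`‖v‖ = O(μ)` and `‖∇v‖ = O(1)`, which turns the factor `λ` of the time derivative of the transient
symbol into `λμ = c(0)/ω`.
-/

noncomputable section

/-! ### Unbounded operators with a bounded inverse of `1 + A` -/

section InverseOneAdd

variable {H : Type*} [NormedAddCommGroup H] [InnerProductSpace ℂ H]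

theorem IsInverseOneAdd.unique {A : H →ₗ.[ℂ] H} {R S : H →L[ℂ] H} (hR : IsInverseOneAdd A R)
    (hS : IsInverseOneAdd A S) : R = S := by
  ext x
  obtain ⟨hx, h⟩ := hR.1 x
  have := hS.2 ⟨R x, hx⟩
  rw [h] at this
  exact this.symm

theorem IsInverseOneAdd.invOneAdd_eq {A : H →ₗ.[ℂ] H} {R : H →L[ℂ] H}
    (hR : IsInverseOneAdd A R) : invOneAdd A = R := by
  have h : ∃ R : H →L[ℂ] H, IsInverseOneAdd A R := ⟨R, hR⟩
  rw [invOneAdd, dif_pos h]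
  exact h.choose_spec.unique hR

theorem IsInverseOneAdd.injective {A : H →ₗ.[ℂ] H} {R : H →L[ℂ] H}
    (hR : IsInverseOneAdd A R) : Function.Injective R := by
  rw [injective_iff_map_eq_zero]
  intro x hx
  obtain ⟨h, h'⟩ := hR.1 x
  have h0 : (⟨R x, h⟩ : A.domain) = 0 := Subtype.ext hx
  rw [h0, LinearPMap.map_zero, hx, add_zero] at h'
  exact h'.symm

/-- If `1 + A` has an everywhere defined bounded self-adjoint inverse, then `A` is self-adjoint;
its domain is dense as the range of an injective self-adjoint operator. -/
theorem IsInverseOneAdd.isSelfAdjoint [CompleteSpace H] {A : H →ₗ.[ℂ] H} {R : H →L[ℂ] H}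
    (hR : IsInverseOneAdd A R) (hsa : IsSelfAdjoint R) : IsSelfAdjoint A := by
  have hsymm : ∀ x y : H, inner ℂ (R x) y = inner ℂ x (R y) := fun x y => by
    rw [← ContinuousLinearMap.adjoint_inner_right, hsa.adjoint_eq]
  have hdense : Dense (A.domain : Set H) := by
    have h1 : Dense (LinearMap.range (R : H →ₗ[ℂ] H) : Set H) := by
      rw [Submodule.dense_iff_topologicalClosure_eq_top,
        Submodule.topologicalClosure_eq_top_iff, Submodule.eq_bot_iff]
      intro x hx
      apply hR.injective
      rw [map_zero]
      refine ext_inner_left ℂ fun y => ?_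
      rw [← hsymm, inner_zero_right]
      exact hx _ ⟨y, rfl⟩
    refine h1.mono ?_
    rintro _ ⟨x, rfl⟩
    exact (hR.1 x).1
  have key : ∀ x : H, ∀ hx : R x ∈ A.domain, A ⟨R x, hx⟩ = x - R x := fun x hx =>
    eq_sub_of_add_eq' (hR.1 x).2
  have hle : A ≤ A.adjoint := by
    refine LinearPMap.IsFormalAdjoint.le_adjoint hdense fun x y => ?_
    have hx := hR.2 x
    have hy := hR.2 y
    set a := (x : H) + A x
    set b := (y : H) + A y
    have hAx : A x = a - R a := by rw [hx]; simp [a]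
    have hAy : A y = b - R b := by rw [hy]; simp [b]
    rw [hAx, hAy, ← hx, ← hy, inner_sub_left, inner_sub_right, hsymm, hsymm]
  rw [LinearPMap.isSelfAdjoint_def]
  refine (LinearPMap.eq_of_le_of_domain_eq hle (le_antisymm hle.1 ?_)).symm
  intro y hy
  have hz := LinearPMap.adjoint_isFormalAdjoint hdense ⟨y, hy⟩
  set z := A.adjoint ⟨y, hy⟩
  have : y = R (y + z) := by
    -- Test `⟨A x, y⟩ = ⟨x, z⟩` on `x = R f`, where `A x = f - R f`.
    refine ext_inner_right ℂ fun f => ?_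
    obtain ⟨hf, hf'⟩ := hR.1 f
    have h2 := hz ⟨R f, hf⟩
    rw [key f hf, inner_sub_right] at h2
    simp only at h2
    rw [hsymm, inner_add_left, h2]
    ring
  rw [this]
  exact (hR.1 _).1

end InverseOneAdd

/-! ### Functions of the form operator `J J*` -/

section FormOperator

variable {H K : Type*} [NormedAddCommGroup H] [InnerProductSpace ℂ H] [CompleteSpace H]
  [NormedAddCommGroup K] [InnerProductSpace ℂ K] [CompleteSpace K]

/-- The function of the resolvent `R = (1 + A)⁻¹` that represents `f(√A)`: the point `z` of the
spectrum of `R` corresponds to `ξ = (1/z - 1) ^ (1/2)`, and `z = 0` to `ξ = ∞`. -/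
def resolventSymbol (f : ℝ → ℂ) (z : ℂ) : ℂ :=
  if z = 0 then 0 else f (Real.sqrt (z.re⁻¹ - 1))

/-- The symbols for which the functional calculus is used: continuous functions tending to `0`
at infinity. -/
structure IsSymbol (f : ℝ → ℂ) : Prop where
  cont : Continuous f
  lim : Filter.Tendsto f Filter.atTop (nhds 0)

theorem IsSymbol.star {f : ℝ → ℂ} (hf : IsSymbol f) : IsSymbol fun ξ => star (f ξ) :=
  ⟨hf.cont.star, by simpa using hf.lim.star⟩

theorem IsSymbol.sub {f g : ℝ → ℂ} (hf : IsSymbol f) (hg : IsSymbol g) :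
    IsSymbol fun ξ => f ξ - g ξ :=
  ⟨hf.cont.sub hg.cont, by simpa using hf.lim.sub hg.lim⟩

theorem IsSymbol.const_mul {f : ℝ → ℂ} (hf : IsSymbol f) (a : ℂ) :
    IsSymbol fun ξ => a * f ξ :=
  ⟨continuous_const.mul hf.cont, by simpa using hf.lim.const_mul a⟩

theorem IsSymbol.re {f : ℝ → ℂ} (hf : IsSymbol f) : IsSymbol fun ξ => ((f ξ).re : ℂ) :=
  ⟨Complex.continuous_ofReal.comp (Complex.continuous_re.comp hf.cont), by
    have h := ((Complex.continuous_ofReal.comp Complex.continuous_re).tendsto 0).comp hf.lim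
    rwa [Function.comp_apply, Complex.zero_re, Complex.ofReal_zero] at h⟩

theorem IsSymbol.mul_bounded {f g : ℝ → ℂ} (hf : IsSymbol f) (hg : Continuous g) {C : ℝ}
    (hC : ∀ ξ, ‖g ξ‖ ≤ C) : IsSymbol fun ξ => g ξ * f ξ := by
  refine ⟨hg.mul hf.cont, ?_⟩
  refine squeeze_zero_norm (a := fun ξ => C * ‖f ξ‖) (fun ξ => ?_) ?_
  · rw [norm_mul]
    exact mul_le_mul_of_nonneg_right (hC ξ) (norm_nonneg _)
  · simpa using hf.lim.norm.const_mul C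

theorem IsSymbol.comp_div {f : ℝ → ℂ} (hf : IsSymbol f) {a : ℝ} (ha : 0 < a) :
    IsSymbol fun ξ => f (ξ / a) :=
  ⟨hf.cont.comp (continuous_id.div_const a),
    hf.lim.comp (Filter.tendsto_id.atTop_div_const ha)⟩

theorem continuousOn_resolventSymbol {f : ℝ → ℂ} (hf : IsSymbol f) {s : Set ℂ}
    (hs : ∀ z ∈ s, ∃ r ∈ Icc (0 : ℝ) 1, z = r) : ContinuousOn (resolventSymbol f) s := by
  intro z hz
  obtain ⟨r, hr, rfl⟩ := hs z hz
  by_cases h0 : r = 0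
  · subst h0
    rw [ContinuousWithinAt]
    have h1 : resolventSymbol f ((0 : ℝ) : ℂ) = 0 := by simp [resolventSymbol]
    rw [h1, Metric.tendsto_nhds]
    intro ε hε
    have h2 := (Metric.tendsto_nhds.1 hf.lim) ε hε
    obtain ⟨M, hM⟩ := Filter.eventually_atTop.1 h2
    have hMpos : 0 < (M ^ 2 + 1)⁻¹ := by positivity
    have h3 : ∀ᶠ z : ℂ in nhdsWithin ((0 : ℝ) : ℂ) s, z.re < (M ^ 2 + 1)⁻¹ := by
      apply nhdsWithin_le_nhds
      apply (Complex.continuous_re.tendsto _).eventually_lt_const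
      simpa using hMpos
    filter_upwards [h3, self_mem_nhdsWithin] with z hz hzs
    obtain ⟨r, hr, rfl⟩ := hs z hzs
    by_cases h0 : r = 0
    · simp [resolventSymbol, h0, hε]
    · have hr0 : 0 < r := lt_of_le_of_ne hr.1 (Ne.symm h0)
      simp only [resolventSymbol, Complex.ofReal_eq_zero, h0, if_false, Complex.ofReal_re]
      apply hM
      apply Real.le_sqrt_of_sq_le
      simp only [Complex.ofReal_re] at hz
      have := (lt_inv_comm₀ hr0 (by positivity)).1 hz
      linarith
  · have hc : ContinuousAt (fun z : ℂ => f (Real.sqrt (z.re⁻¹ - 1))) (r : ℂ) := by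
      refine hf.cont.continuousAt.comp (Real.continuous_sqrt.continuousAt.comp ?_)
      refine ContinuousAt.sub (ContinuousAt.inv₀ Complex.continuous_re.continuousAt ?_)
        continuousAt_const
      simpa using h0
    refine (hc.congr ?_).continuousWithinAt
    have : ∀ᶠ z : ℂ in nhds (r : ℂ), z ≠ 0 :=
      isOpen_ne.mem_nhds (by simpa using h0)
    filter_upwards [this] with z hz
    simp [resolventSymbol, hz]

open ContinuousLinearMap (adjoint)

variable (J : K →L[ℂ] H)

/-- The operator `J J*`. When `K` is the form domain of a nonnegative self-adjoint operator `A`,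
with the norm `⟨(1 + A) u, u⟩ ^ (1/2)`, and `J` is its embedding, this is `(1 + A)⁻¹`. -/
def formResolvent : H →L[ℂ] H := J ∘L adjoint J

theorem formResolvent_apply (f : H) : formResolvent J f = J (adjoint J f) := rfl

theorem inner_formResolvent (f g : H) :
    inner ℂ f (formResolvent J g) = inner ℂ (adjoint J f) (adjoint J g) := by
  rw [formResolvent_apply, ContinuousLinearMap.adjoint_inner_left]

theorem formResolvent_nonneg : 0 ≤ formResolvent J :=
  (ContinuousLinearMap.nonneg_iff_isPositive _).2 J.isPositive_self_comp_adjoint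

theorem isSelfAdjoint_formResolvent : IsSelfAdjoint (formResolvent J) :=
  (formResolvent_nonneg J).isSelfAdjoint

variable {J}

theorem norm_formResolvent_le (hJ : ‖J‖ ≤ 1) : ‖formResolvent J‖ ≤ 1 := by
  refine (ContinuousLinearMap.opNorm_comp_le _ _).trans ?_
  rw [LinearIsometryEquiv.norm_map]
  exact mul_le_one₀ hJ (norm_nonneg _) hJ

theorem spectrum_formResolvent (hJ : ‖J‖ ≤ 1) :
    ∀ z ∈ spectrum ℂ (formResolvent J), ∃ r ∈ Icc (0 : ℝ) 1, z = r := by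
  intro z hz
  have h1 := (isSelfAdjoint_formResolvent J).mem_spectrum_eq_re hz
  refine ⟨z.re, ⟨?_, ?_⟩, h1⟩
  · rw [h1] at hz
    exact spectrum_nonneg_of_nonneg (formResolvent_nonneg J)
      ((spectrum.algebraMap_mem_iff ℂ (R := ℝ)).1 hz)
  · refine (Complex.re_le_norm z).trans ((spectrum.norm_le_norm_mul_of_mem hz).trans ?_)
    exact mul_le_one₀ (norm_formResolvent_le hJ) (norm_nonneg _) ContinuousLinearMap.norm_id_le

theorem norm_cfc_formResolvent_le {f : ℝ → ℂ} {C : ℝ} (hC : ∀ ξ, ‖f ξ‖ ≤ C) :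
    ‖cfc (resolventSymbol f) (formResolvent J)‖ ≤ C := by
  have hC0 : 0 ≤ C := (norm_nonneg _).trans (hC 0)
  refine norm_cfc_le hC0 fun z _ => ?_
  rw [resolventSymbol]
  split_ifs
  · simpa using hC0
  · exact hC _

theorem cfc_formResolvent_star (f : ℝ → ℂ) :
    cfc (resolventSymbol fun ξ => star (f ξ)) (formResolvent J) =
      star (cfc (resolventSymbol f) (formResolvent J)) := by
  rw [← cfc_star]
  congr 1
  ext z
  simp only [resolventSymbol]
  split_ifs <;> simp

theorem cfc_formResolvent_sub (hJ : ‖J‖ ≤ 1) {f g : ℝ → ℂ} (hf : IsSymbol f)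
    (hg : IsSymbol g) :
    cfc (resolventSymbol fun ξ => f ξ - g ξ) (formResolvent J) =
      cfc (resolventSymbol f) (formResolvent J) - cfc (resolventSymbol g) (formResolvent J) := by
  have hs := spectrum_formResolvent hJ
  rw [← cfc_sub _ _ _ (continuousOn_resolventSymbol hf hs) (continuousOn_resolventSymbol hg hs)]
  congr 1
  ext z
  simp only [resolventSymbol]
  split_ifs <;> simp

theorem cfc_formResolvent_const_mul (hJ : ‖J‖ ≤ 1) {f : ℝ → ℂ} (hf : IsSymbol f) (a : ℂ) :
    cfc (resolventSymbol fun ξ => a * f ξ) (formResolvent J) =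
      a • cfc (resolventSymbol f) (formResolvent J) := by
  have hs := spectrum_formResolvent hJ
  rw [← cfc_smul a _ _ (continuousOn_resolventSymbol hf hs)]
  congr 1
  ext z
  simp only [resolventSymbol]
  split_ifs <;> simp

/-- The real part of `f(√A)` is `(Re f)(√A)`. -/
theorem realPart_cfc_formResolvent (hJ : ‖J‖ ≤ 1) {f : ℝ → ℂ} (hf : IsSymbol f) :
    ((ℜ (cfc (resolventSymbol f) (formResolvent J)) : selfAdjoint (H →L[ℂ] H)) : H →L[ℂ] H) =
      cfc (resolventSymbol fun ξ => ((f ξ).re : ℂ)) (formResolvent J) := by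
  have hs := spectrum_formResolvent hJ
  have h1 : (fun ξ => ((f ξ).re : ℂ)) = fun ξ => (1 / 2 : ℂ) * (f ξ - (-1) * star (f ξ)) := by
    ext ξ
    rw [Complex.re_eq_add_conj, ← Complex.star_def]
    ring
  rw [h1, cfc_formResolvent_const_mul hJ (hf.sub (hf.star.const_mul _)),
    cfc_formResolvent_sub hJ hf (hf.star.const_mul _), cfc_formResolvent_const_mul hJ hf.star,
    cfc_formResolvent_star, realPart_apply_coe, ← Complex.coe_smul]
  simp

/-- If `|f(ξ)| ≤ C √(1 + ξ²)`, then `f(√A)` is bounded by `C` from the form domain to `H`. -/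
theorem norm_cfc_formResolvent_comp_le (hJ : ‖J‖ ≤ 1) {f : ℝ → ℂ} (hf : IsSymbol f)
    {C : ℝ} (hC0 : 0 ≤ C)
    (hC : ∀ ξ, ‖f ξ‖ ^ 2 ≤ C ^ 2 * (1 + ξ ^ 2)) :
    ‖cfc (resolventSymbol f) (formResolvent J) ∘L J‖ ≤ C := by
  have hs := spectrum_formResolvent hJ
  have hcont := continuousOn_resolventSymbol hf hs
  have hcont' : ContinuousOn (fun z => star (resolventSymbol f z))
    (spectrum ℂ (formResolvent J)) := hcont.star
  set T := cfc (resolventSymbol f) (formResolvent J) with hT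
  -- `(T J) (T J)* = T R T*` is again a function of `R`, namely `r |F(r)|²`.
  have h1 : (T ∘L J) ∘L adjoint (T ∘L J) =
      cfc (fun z => resolventSymbol f z * z * star (resolventSymbol f z)) (formResolvent J) := by
    have hsn : IsStarNormal (formResolvent J) := (isSelfAdjoint_formResolvent J).isStarNormal
    rw [cfc_mul (fun z => resolventSymbol f z * z) _ _ (hcont.mul continuousOn_id) hcont',
      cfc_mul _ (fun z => z) _ hcont continuousOn_id,
      cfc_star, cfc_id' ℂ (formResolvent J), ContinuousLinearMap.adjoint_comp]
    rfl
  have h2 : ‖(T ∘L J) ∘L adjoint (T ∘L J)‖ = ‖T ∘L J‖ * ‖T ∘L J‖ := by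
    have := ContinuousLinearMap.norm_adjoint_comp_self (adjoint (T ∘L J))
    rwa [ContinuousLinearMap.adjoint_adjoint, LinearIsometryEquiv.norm_map] at this
  have h3 : ‖(T ∘L J) ∘L adjoint (T ∘L J)‖ ≤ C ^ 2 := by
    rw [h1]
    refine norm_cfc_le (by positivity) fun z hz => ?_
    obtain ⟨r, hr, rfl⟩ := hs z hz
    by_cases h0 : r = 0
    · simp [h0, resolventSymbol]; positivity
    have hr0 : 0 < r := lt_of_le_of_ne hr.1 (Ne.symm h0)
    simp only [resolventSymbol, Complex.ofReal_eq_zero, h0, if_false, Complex.ofReal_re, norm_mul,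
      norm_star, Complex.norm_real, Real.norm_eq_abs, abs_of_pos hr0]
    have h4 := hC (Real.sqrt (r⁻¹ - 1))
    rw [Real.sq_sqrt (sub_nonneg.2 ((one_le_inv₀ hr0).2 hr.2))] at h4
    calc _ = ‖f (Real.sqrt (r⁻¹ - 1))‖ ^ 2 * r := by ring
      _ ≤ C ^ 2 * (1 + (r⁻¹ - 1)) * r := by gcongr
      _ = C ^ 2 := by field_simp; ring
  rw [h2, ← sq] at h3
  exact (sq_le_sq₀ (norm_nonneg _) hC0).1 h3

theorem denseRange_adjoint_of_injective (hinj : Function.Injective J) :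
    DenseRange (adjoint J) := by
  have h := J.orthogonal_ker
  have h0 : J.ker = ⊥ := LinearMap.ker_eq_bot.2 hinj
  rw [h0, Submodule.bot_orthogonal_eq_top] at h
  have := Submodule.dense_iff_topologicalClosure_eq_top.2 h.symm
  exact this

/-- The operators `f(√A)` act on the form domain, with the same bound. -/
theorem exists_cfc_formResolvent_apply_eq (hJ : ‖J‖ ≤ 1) (hinj : Function.Injective J)
    {f : ℝ → ℂ} {C : ℝ} (hC : ∀ ξ, ‖f ξ‖ ≤ C) (k : K) :
    ∃ k' : K, J k' = cfc (resolventSymbol f) (formResolvent J) (J k) ∧ ‖k'‖ ≤ C * ‖k‖ := by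
  set T := cfc (resolventSymbol f) (formResolvent J) with hT
  have hsa := isSelfAdjoint_formResolvent J
  have hsn : IsStarNormal (formResolvent J) := hsa.isStarNormal
  -- The square root `S` of `R` satisfies `‖S x‖ = ‖J* x‖` and commutes with `T`.
  set S := cfc (fun z : ℂ => ((Real.sqrt z.re : ℝ) : ℂ)) (formResolvent J) with hS
  have hScont : Continuous (fun z : ℂ => ((Real.sqrt z.re : ℝ) : ℂ)) := by fun_prop
  have hSS : S ∘L S = formResolvent J := by
    change S * S = _
    rw [hS, ← cfc_mul _ _ _ hScont.continuousOn hScont.continuousOn]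
    conv_rhs => rw [← cfc_id' ℂ (formResolvent J)]
    refine cfc_congr fun z hz => ?_
    obtain ⟨r, hr, rfl⟩ := spectrum_formResolvent hJ z hz
    simp only [Complex.ofReal_re]
    rw [← Complex.ofReal_mul, Real.mul_self_sqrt hr.1]
  have hSsa : adjoint S = S := by
    change star S = S
    rw [hS, ← cfc_star]
    simp
  have hnorm : ∀ x, ‖S x‖ = ‖adjoint J x‖ := by
    intro x
    have h1 : inner ℂ (S x) (S x) = inner ℂ (adjoint J x) (adjoint J x) := by
      rw [← inner_formResolvent, ← hSS, ContinuousLinearMap.comp_apply]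
      rw [← ContinuousLinearMap.adjoint_inner_right, hSsa]
    rw [inner_self_eq_norm_sq_to_K, inner_self_eq_norm_sq_to_K] at h1
    have h2 : ‖S x‖ ^ 2 = ‖adjoint J x‖ ^ 2 := by exact_mod_cast h1
    exact (sq_eq_sq₀ (norm_nonneg _) (norm_nonneg _)).1 h2
  have hcomm : ∀ x, S (T x) = T (S x) := fun x =>
    DFunLike.congr_fun (cfc_commute_cfc (fun z : ℂ => ((Real.sqrt z.re : ℝ) : ℂ))
      (resolventSymbol f) (formResolvent J)).eq x
  have hcommR : ∀ x, formResolvent J (T x) = T (formResolvent J x) := fun x => by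
    rw [← hSS, ContinuousLinearMap.comp_apply, ContinuousLinearMap.comp_apply, hcomm, hcomm]
  have hT_le : ‖T‖ ≤ C := norm_cfc_formResolvent_le hC
  have hdense := denseRange_adjoint_of_injective hinj
  have hbound : ∀ x, ‖((adjoint J ∘L T : H →L[ℂ] K) : H →ₗ[ℂ] K) x‖
      ≤ C * ‖((adjoint J : H →L[ℂ] K) : H →ₗ[ℂ] K) x‖ := by
    intro x
    change ‖adjoint J (T x)‖ ≤ C * ‖adjoint J x‖
    rw [← hnorm, ← hnorm, hcomm]
    exact T.le_of_opNorm_le hT_le _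
  -- Since `J J* T = T J J*`, the map `J* x ↦ J* T x` extends to an operator `U` with `J U = T J`.
  set U := LinearMap.extendOfNorm ((adjoint J ∘L T : H →L[ℂ] K) : H →ₗ[ℂ] K)
    ((adjoint J : H →L[ℂ] K) : H →ₗ[ℂ] K)
  have hU : J ∘L U = T ∘L J := by
    apply ContinuousLinearMap.coeFn_injective
    refine hdense.equalizer (J ∘L U).continuous (T ∘L J).continuous ?_
    ext x
    have h1 : U (adjoint J x) = adjoint J (T x) :=
      LinearMap.extendOfNorm_eq hdense ⟨C, hbound⟩ x
    simp only [Function.comp_apply, ContinuousLinearMap.comp_apply, h1]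
    exact hcommR x
  refine ⟨U k, DFunLike.congr_fun hU k, ?_⟩
  exact LinearMap.norm_extendOfNorm_apply_le hdense C hbound k

/-- A family of functions of `R` is differentiable in operator norm as soon as the symbols satisfy
a first-order Taylor estimate uniformly in the spectral parameter. -/
theorem hasDerivWithinAt_cfc_formResolvent (hJ : ‖J‖ ≤ 1) {p : ℝ → ℝ → ℂ} {p' : ℝ → ℂ}
    {s : Set ℝ} {t₀ C : ℝ}
    (hp : ∀ t ∈ s, IsSymbol (p t)) (hp' : IsSymbol p') (ht₀ : t₀ ∈ s)
    (hC : ∀ t ∈ s, ∀ ξ, ‖p t ξ - p t₀ ξ - ((t - t₀ : ℝ) : ℂ) * p' ξ‖ ≤ C * (t - t₀) ^ 2) :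
    HasDerivWithinAt (fun t => cfc (resolventSymbol (p t)) (formResolvent J))
      (cfc (resolventSymbol p') (formResolvent J)) s t₀ := by
  rw [hasDerivWithinAt_iff_isLittleO]
  refine Asymptotics.IsBigO.trans_isLittleO (g := fun t => (t - t₀) ^ 2) ?_ ?_
  · refine Asymptotics.IsBigO.of_bound C ?_
    filter_upwards [self_mem_nhdsWithin] with t ht
    rw [← Complex.coe_smul, ← cfc_formResolvent_const_mul hJ hp',
      ← cfc_formResolvent_sub hJ (hp t ht) (hp t₀ ht₀),
      ← cfc_formResolvent_sub hJ ((hp t ht).sub (hp t₀ ht₀)) (hp'.const_mul _), Real.norm_eq_abs,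
      abs_of_nonneg (sq_nonneg _)]
    exact norm_cfc_formResolvent_le (hC t ht)
  · have h1 : Asymptotics.IsLittleO (nhds t₀) (fun t => (t - t₀) ^ 2) fun t => t - t₀ := by
      have := (Asymptotics.isLittleO_pow_id (𝕜 := ℝ) one_lt_two)
      have h2 : Filter.Tendsto (fun t : ℝ => t - t₀) (nhds t₀) (nhds 0) := by
        have : Continuous fun t : ℝ => t - t₀ := by fun_prop
        simpa using this.tendsto t₀
      exact this.comp_tendsto h2
    exact h1.mono nhdsWithin_le_nhds

end FormOperator

/-! ### One-sided Fourier integrals of exponentially decaying functions -/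

/-- A function continuous on `[0, ∞)` and bounded there by `C exp (-ν τ)`. -/
structure IsExpDecaying (h : ℝ → ℝ) (ν C : ℝ) : Prop where
  cont : ContinuousOn h (Ici 0)
  bound : ∀ τ, 0 ≤ τ → |h τ| ≤ C * Real.exp (-ν * τ)

theorem norm_exp_neg_I_mul (η τ : ℝ) : ‖Complex.exp (-Complex.I * η * τ)‖ = 1 := by
  have : -Complex.I * η * τ = ((-(η * τ) : ℝ) : ℂ) * Complex.I := by push_cast; ring
  rw [this, Complex.norm_exp_ofReal_mul_I]

section

variable {h h' h'' : ℝ → ℝ} {ν C C' C'' : ℝ}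

theorem IsExpDecaying.nonneg (hh : IsExpDecaying h ν C) : 0 ≤ C := by
  simpa using (abs_nonneg _).trans (hh.bound 0 le_rfl)

theorem IsExpDecaying.norm_integrand_le (hh : IsExpDecaying h ν C) {s : ℝ} (hs : 0 ≤ s)
    (η : ℝ) {τ : ℝ} (hτ : 0 ≤ τ) :
    ‖Complex.exp (-Complex.I * η * τ) * (h (τ + s) : ℂ)‖
      ≤ C * Real.exp (-ν * s) * Real.exp (-ν * τ) := by
  rw [norm_mul, norm_exp_neg_I_mul, one_mul, Complex.norm_real, Real.norm_eq_abs, mul_assoc,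
    ← Real.exp_add]
  refine (hh.bound _ (by positivity)).trans (le_of_eq ?_)
  ring_nf

theorem IsExpDecaying.continuousOn_shift (hh : IsExpDecaying h ν C) {s : ℝ} (hs : 0 ≤ s) :
    ContinuousOn (fun τ => (h (τ + s) : ℂ)) (Ici 0) := by
  refine Complex.continuous_ofReal.comp_continuousOn
    (hh.cont.comp (by fun_prop) fun τ hτ => ?_)
  exact add_nonneg hτ hs

theorem IsExpDecaying.aestronglyMeasurable (hh : IsExpDecaying h ν C) {s : ℝ} (hs : 0 ≤ s)
    (η : ℝ) : AEStronglyMeasurable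
      (fun τ : ℝ => Complex.exp (-Complex.I * η * τ) * (h (τ + s) : ℂ))
      (volume.restrict (Ioi 0)) := by
  refine ContinuousOn.aestronglyMeasurable ?_ measurableSet_Ioi
  exact (Continuous.continuousOn (by fun_prop)).mul
    ((hh.continuousOn_shift hs).mono Ioi_subset_Ici_self)

theorem integrable_const_mul_exp_neg (hν : 0 < ν) (a : ℝ) :
    Integrable (fun τ => a * Real.exp (-ν * τ)) (volume.restrict (Ioi (0 : ℝ))) :=
  (integrableOn_exp_mul_Ioi (neg_neg_of_pos hν) 0).const_mul a

theorem IsExpDecaying.integrable (hh : IsExpDecaying h ν C) (hν : 0 < ν) {s : ℝ} (hs : 0 ≤ s)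
    (η : ℝ) : Integrable (fun τ : ℝ => Complex.exp (-Complex.I * η * τ) * (h (τ + s) : ℂ))
      (volume.restrict (Ioi 0)) := by
  refine (integrable_const_mul_exp_neg hν (C * Real.exp (-ν * s))).mono'
    (hh.aestronglyMeasurable hs η) ?_
  filter_upwards [ae_restrict_mem measurableSet_Ioi] with τ hτ
  exact hh.norm_integrand_le hs η (le_of_lt hτ)

theorem integral_const_mul_exp_neg (hν : 0 < ν) (a : ℝ) :
    ∫ τ in Ioi (0 : ℝ), a * Real.exp (-ν * τ) = a / ν := by
  rw [integral_const_mul, integral_exp_mul_Ioi (neg_neg_of_pos hν)]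
  field_simp
  simp

theorem IsExpDecaying.norm_transSymbol_le (hh : IsExpDecaying h ν C) (hν : 0 < ν) {s : ℝ}
    (hs : 0 ≤ s) (η : ℝ) : ‖transSymbol h η s‖ ≤ C / ν * Real.exp (-ν * s) := by
  rw [transSymbol]
  refine (norm_integral_le_of_norm_le (integrable_const_mul_exp_neg hν (C * Real.exp (-ν * s)))
    ?_).trans (le_of_eq ?_)
  · filter_upwards [ae_restrict_mem measurableSet_Ioi] with τ hτ
    exact hh.norm_integrand_le hs η (le_of_lt hτ)
  · rw [integral_const_mul_exp_neg hν]
    ring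

theorem IsExpDecaying.continuous_transSymbol (hh : IsExpDecaying h ν C) (hν : 0 < ν) {s : ℝ}
    (hs : 0 ≤ s) : Continuous fun η => transSymbol h η s := by
  refine continuous_of_dominated (fun η => hh.aestronglyMeasurable hs η) (fun η => ?_)
    (integrable_const_mul_exp_neg hν (C * Real.exp (-ν * s))) ?_
  · filter_upwards [ae_restrict_mem measurableSet_Ioi] with τ hτ
    exact hh.norm_integrand_le hs η (le_of_lt hτ)
  · exact Filter.Eventually.of_forall fun τ => by fun_prop

/-- Integration by parts in the one-sided Fourier integral. -/
theorem IsExpDecaying.I_mul_transSymbol (hh : IsExpDecaying h ν C)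
    (hh' : IsExpDecaying h' ν C') (hν : 0 < ν)
    (hd : ∀ τ, 0 ≤ τ → HasDerivWithinAt h (h' τ) (Ici 0) τ) {s : ℝ} (hs : 0 ≤ s) (η : ℝ) :
    Complex.I * η * transSymbol h η s = h s + transSymbol h' η s := by
  have hint := hh.integrable hν hs η
  have hint' := hh'.integrable hν hs η
  have hderiv : ∀ τ ∈ Ioi (0 : ℝ), HasDerivAt
      (fun τ : ℝ => Complex.exp (-Complex.I * η * τ) * (h (τ + s) : ℂ))
      (-Complex.I * η * (Complex.exp (-Complex.I * η * τ) * (h (τ + s) : ℂ)) +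
        Complex.exp (-Complex.I * η * τ) * (h' (τ + s) : ℂ)) τ := by
    intro τ hτ
    have hτ' : (0 : ℝ) < τ + s := add_pos_of_pos_of_nonneg hτ hs
    have h1 : HasDerivAt h (h' (τ + s)) (τ + s) :=
      (hd _ hτ'.le).hasDerivAt (Ici_mem_nhds hτ')
    have h2 : HasDerivAt (fun τ : ℝ => (h (τ + s) : ℂ)) (h' (τ + s) : ℂ) τ :=
      (h1.comp_add_const τ s).ofReal_comp
    have h3 : HasDerivAt (fun τ : ℝ => Complex.exp (-Complex.I * η * τ))
        (Complex.exp (-Complex.I * η * τ) * (-Complex.I * η)) τ := by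
      have h4 : HasDerivAt (fun τ : ℝ => -Complex.I * η * (τ : ℂ)) (-Complex.I * η) τ := by
        simpa using (Complex.ofRealCLM.hasDerivAt (x := τ)).const_mul (-Complex.I * η)
      exact h4.cexp
    refine (h3.mul h2).congr_deriv ?_
    ring
  have hlim : Filter.Tendsto (fun τ : ℝ => Complex.exp (-Complex.I * η * τ) * (h (τ + s) : ℂ))
      Filter.atTop (nhds 0) := by
    refine squeeze_zero_norm' (a := fun τ => C * Real.exp (-ν * s) * Real.exp (-ν * τ)) ?_ ?_
    · filter_upwards [Filter.eventually_ge_atTop 0] with τ hτ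
      exact hh.norm_integrand_le hs η hτ
    · have : Filter.Tendsto (fun τ : ℝ => Real.exp (-ν * τ)) Filter.atTop (nhds 0) :=
        Real.tendsto_exp_atBot.comp
          (Filter.tendsto_id.const_mul_atTop_of_neg (neg_neg_of_pos hν))
      simpa using this.const_mul (C * Real.exp (-ν * s))
  have hcont : ContinuousWithinAt
      (fun τ : ℝ => Complex.exp (-Complex.I * η * τ) * (h (τ + s) : ℂ)) (Ici 0) 0 :=
    ((Continuous.continuousOn (by fun_prop)).mul (hh.continuousOn_shift hs)) 0 self_mem_Ici
  have := integral_Ioi_of_hasDerivAt_of_tendsto hcont hderiv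
    ((hint.const_mul _).add hint') hlim
  rw [integral_add (hint.const_mul _) hint', integral_const_mul] at this
  simp only [Complex.ofReal_zero, mul_zero, Complex.exp_zero, one_mul, zero_add, zero_sub] at this
  rw [transSymbol, transSymbol]
  linear_combination -this

theorem IsExpDecaying.abs_mul_norm_transSymbol_le (hh : IsExpDecaying h ν C)
    (hh' : IsExpDecaying h' ν C') (hν : 0 < ν)
    (hd : ∀ τ, 0 ≤ τ → HasDerivWithinAt h (h' τ) (Ici 0) τ) {s : ℝ} (hs : 0 ≤ s) (η : ℝ) :
    |η| * ‖transSymbol h η s‖ ≤ |h s| + C' / ν * Real.exp (-ν * s) := by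
  have h1 := congrArg norm (hh.I_mul_transSymbol hh' hν hd hs η)
  rw [norm_mul, norm_mul, Complex.norm_I, one_mul, Complex.norm_real, Real.norm_eq_abs] at h1
  rw [h1]
  refine (norm_add_le _ _).trans ?_
  rw [Complex.norm_real, Real.norm_eq_abs]
  gcongr
  exact hh'.norm_transSymbol_le hν hs η

theorem IsExpDecaying.isSymbol_transSymbol (hh : IsExpDecaying h ν C)
    (hh' : IsExpDecaying h' ν C') (hν : 0 < ν)
    (hd : ∀ τ, 0 ≤ τ → HasDerivWithinAt h (h' τ) (Ici 0) τ) {s : ℝ} (hs : 0 ≤ s) :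
    IsSymbol fun η => transSymbol h η s := by
  refine ⟨hh.continuous_transSymbol hν hs, ?_⟩
  refine squeeze_zero_norm' (a := fun η => (|h s| + C' / ν * Real.exp (-ν * s)) / η) ?_
    (Filter.tendsto_id.const_div_atTop _)
  filter_upwards [Filter.eventually_gt_atTop 0] with η hη
  rw [le_div_iff₀ hη, mul_comm]
  simpa [abs_of_pos hη] using hh.abs_mul_norm_transSymbol_le hh' hν hd hs η

/-- If `h` vanishes at `0`, its one-sided Fourier integral decays quadratically. -/
theorem IsExpDecaying.exists_norm_transSymbol_zero_le (hh : IsExpDecaying h ν C)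
    (hh' : IsExpDecaying h' ν C') (hh'' : IsExpDecaying h'' ν C'') (hν : 0 < ν)
    (hd : ∀ τ, 0 ≤ τ → HasDerivWithinAt h (h' τ) (Ici 0) τ)
    (hd' : ∀ τ, 0 ≤ τ → HasDerivWithinAt h' (h'' τ) (Ici 0) τ) (h0 : h 0 = 0) :
    ∃ M, 0 ≤ M ∧ ∀ η, (1 + η ^ 2) * ‖transSymbol h η 0‖ ≤ M := by
  refine ⟨C / ν + (|h' 0| + C'' / ν), ?_, fun η => ?_⟩
  · have := hh.nonneg
    have := hh''.nonneg
    positivity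
  · have h1 := hh.norm_transSymbol_le hν le_rfl η
    have h2 := hh'.abs_mul_norm_transSymbol_le hh'' hν hd' le_rfl η
    have h3 := congrArg norm (hh.I_mul_transSymbol hh' hν hd le_rfl η)
    rw [norm_mul, norm_mul, Complex.norm_I, one_mul, Complex.norm_real, Real.norm_eq_abs, h0,
      Complex.ofReal_zero, zero_add] at h3
    simp only [mul_zero, Real.exp_zero, mul_one] at h1 h2
    rw [← h3] at h2
    have h4 : η ^ 2 = |η| * |η| := by rw [← sq, sq_abs]
    rw [add_mul, one_mul, h4, mul_assoc]
    exact add_le_add h1 h2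

/-- Second order Taylor estimate on a half-line `[τ, ∞)`. The error constant is the supremum of the
second derivative there, so it is integrable in `τ`. -/
theorem abs_taylor_le_of_half_line (hh'' : IsExpDecaying h'' ν C'') (hν : 0 < ν)
    (hd : ∀ τ, 0 ≤ τ → HasDerivWithinAt h (h' τ) (Ici 0) τ)
    (hd' : ∀ τ, 0 ≤ τ → HasDerivWithinAt h' (h'' τ) (Ici 0) τ) {τ x y : ℝ} (hτ : 0 ≤ τ)
    (hx : τ ≤ x) (hy : τ ≤ y) :
    |h y - h x - (y - x) * h' x| ≤ C'' * Real.exp (-ν * τ) * (y - x) ^ 2 := by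
  set B := C'' * Real.exp (-ν * τ)
  have hsub : ∀ z ∈ uIcc x y, τ ≤ z := fun z hz => (le_min hx hy).trans hz.1
  have hsub' : uIcc x y ⊆ Ici 0 := fun z hz => hτ.trans (hsub z hz)
  have h1 : ∀ z ∈ uIcc x y, |h' z - h' x| ≤ B * |y - x| := by
    intro z hz
    have := (convex_uIcc x y).norm_image_sub_le_of_norm_hasDerivWithin_le (f := h') (f' := h'')
      (C := B) (fun w hw => (hd' w (hsub' hw)).mono hsub') (fun w hw => ?_) left_mem_uIcc hz
    · refine this.trans (mul_le_mul_of_nonneg_left ?_ ?_)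
      · exact abs_sub_left_of_mem_uIcc hz
      · exact mul_nonneg hh''.nonneg (Real.exp_nonneg _)
    · refine (hh''.bound w (hsub' hw)).trans (mul_le_mul_of_nonneg_left ?_ hh''.nonneg)
      apply Real.exp_le_exp.2
      have := hsub w hw
      nlinarith
  have h2 := (convex_uIcc x y).norm_image_sub_le_of_norm_hasDerivWithin_le
    (f := fun z => h z - z * h' x) (f' := fun z => h' z - 1 * h' x) (C := B * |y - x|)
    (fun w hw => ((hd w (hsub' hw)).mono hsub').sub ((hasDerivWithinAt_id w _).mul_const _))
    (fun w hw => by simpa using h1 w hw) left_mem_uIcc right_mem_uIcc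
  simp only [Real.norm_eq_abs] at h2
  rw [mul_assoc, ← sq, sq_abs] at h2
  convert h2 using 2
  ring

/-- Taylor estimate in the shift `s`, uniform in the frequency. -/
theorem IsExpDecaying.norm_transSymbol_taylor_le (hh : IsExpDecaying h ν C)
    (hh' : IsExpDecaying h' ν C') (hh'' : IsExpDecaying h'' ν C'') (hν : 0 < ν)
    (hd : ∀ τ, 0 ≤ τ → HasDerivWithinAt h (h' τ) (Ici 0) τ)
    (hd' : ∀ τ, 0 ≤ τ → HasDerivWithinAt h' (h'' τ) (Ici 0) τ) {s t : ℝ} (hs : 0 ≤ s)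
    (ht : 0 ≤ t) (η : ℝ) :
    ‖transSymbol h η t - transSymbol h η s - ((t - s : ℝ) : ℂ) * transSymbol h' η s‖
      ≤ C'' / ν * (t - s) ^ 2 := by
  have i1 := hh.integrable hν ht η
  have i2 := hh.integrable hν hs η
  have i3 := (hh'.integrable hν hs η).const_mul ((t - s : ℝ) : ℂ)
  simp only [transSymbol]
  rw [← integral_sub i1 i2, ← integral_const_mul, ← integral_sub (by exact i1.sub i2) i3]
  refine (norm_integral_le_of_norm_le (integrable_const_mul_exp_neg hν (C'' * (t - s) ^ 2))
    ?_).trans (le_of_eq ?_)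
  · filter_upwards [ae_restrict_mem measurableSet_Ioi] with τ hτ
    have hτ' : 0 ≤ τ := le_of_lt hτ
    have := abs_taylor_le_of_half_line hh'' hν hd hd' hτ' (x := τ + s) (y := τ + t)
      (by linarith) (by linarith)
    have e : Complex.exp (-Complex.I * η * τ) * (h (τ + t) : ℂ)
        - Complex.exp (-Complex.I * η * τ) * (h (τ + s) : ℂ)
        - ((t - s : ℝ) : ℂ) * (Complex.exp (-Complex.I * η * τ) * (h' (τ + s) : ℂ))
        = Complex.exp (-Complex.I * η * τ) *
          ((h (τ + t) - h (τ + s) - (t - s) * h' (τ + s) : ℝ) : ℂ) := by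
      push_cast
      ring
    rw [e, norm_mul, norm_exp_neg_I_mul, one_mul, Complex.norm_real, Real.norm_eq_abs]
    have e2 : τ + t - (τ + s) = t - s := by ring
    rw [e2] at this
    linarith
  · rw [integral_const_mul_exp_neg hν]
    ring

end

/-- The phase `exp (i ξ t)` satisfies a second order Taylor estimate in `t`. -/
theorem norm_exp_taylor_le (ξ s t : ℝ) :
    ‖Complex.exp (Complex.I * ξ * t) - Complex.exp (Complex.I * ξ * s)
      - ((t - s : ℝ) : ℂ) * (Complex.I * ξ * Complex.exp (Complex.I * ξ * s))‖
      ≤ 3 * ξ ^ 2 * (t - s) ^ 2 := by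
  set x : ℝ := ξ * (t - s)
  have e : Complex.exp (Complex.I * ξ * t) - Complex.exp (Complex.I * ξ * s)
      - ((t - s : ℝ) : ℂ) * (Complex.I * ξ * Complex.exp (Complex.I * ξ * s))
      = Complex.exp ((ξ * s : ℝ) * Complex.I) *
        (Complex.exp ((x : ℂ) * Complex.I) - 1 - x * Complex.I) := by
    have e1 : Complex.I * ξ * t = (ξ * s : ℝ) * Complex.I + x * Complex.I := by
      simp only [x]; push_cast; ring
    have e2 : Complex.I * ξ * s = (ξ * s : ℝ) * Complex.I := by push_cast; ring
    rw [e1, e2, Complex.exp_add]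
    simp only [x]; push_cast; ring
  rw [e, norm_mul, Complex.norm_exp_ofReal_mul_I, one_mul, mul_assoc, ← mul_pow]
  change _ ≤ 3 * x ^ 2
  have hx : ‖(x : ℂ) * Complex.I‖ = |x| := by simp
  -- For large `x` the three terms are bounded separately.
  by_cases h1 : |x| ≤ 1
  · have := Complex.norm_exp_sub_one_sub_id_le (x := (x : ℂ) * Complex.I) (by rwa [hx])
    rw [hx, sq_abs] at this
    nlinarith [sq_nonneg x]
  · refine (norm_sub_le _ _).trans ?_
    have h2 := norm_sub_le (Complex.exp ((x : ℂ) * Complex.I)) 1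
    rw [Complex.norm_exp_ofReal_mul_I, norm_one] at h2
    rw [hx]
    have h3 : x ^ 2 = |x| ^ 2 := (sq_abs x).symm
    rw [h3]
    nlinarith [not_le.1 h1]

/-! ### The scaled time profile -/

theorem transSymbol_scaledTime (g₀ : ℝ → ℝ) {lam : ℝ} (hlam : 0 < lam) (ξ t : ℝ) :
    transSymbol (scaledTime g₀ lam) ξ t = transSymbol g₀ (ξ / lam) (lam * t) := by
  have := integral_comp_mul_left_Ioi
    (fun τ : ℝ => Complex.exp (-Complex.I * (ξ / lam : ℝ) * τ) * (g₀ (τ + lam * t) : ℂ)) 0 hlam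
  rw [mul_zero] at this
  have h2 := congrArg (fun z => lam • z) this
  simp only [smul_smul, mul_inv_cancel₀ hlam.ne', one_smul] at h2
  rw [transSymbol, transSymbol, ← h2, ← integral_smul]
  refine integral_congr_ae (Filter.Eventually.of_forall fun τ => ?_)
  have hl : (lam : ℂ) ≠ 0 := Complex.ofReal_ne_zero.2 hlam.ne'
  have e : -Complex.I * ((ξ / lam : ℝ) : ℂ) * ((lam * τ : ℝ) : ℂ) = -Complex.I * ξ * τ := by
    push_cast
    field_simp
  simp only [e, scaledTime, mul_add, Complex.real_smul]
  push_cast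
  ring

theorem sqrt_two_pi_mul_fourierTilde (g : ℝ → ℝ) (ξ : ℝ) :
    ((Real.sqrt (2 * Real.pi) : ℝ) : ℂ) * fourierTilde g ξ = transSymbol g ξ 0 := by
  have h : Real.sqrt (2 * Real.pi) ≠ 0 := by positivity
  rw [fourierTilde, ← mul_assoc, ← Complex.ofReal_mul, mul_inv_cancel₀ h]
  simp [transSymbol]

theorem IsTimeProfile.exists_isExpDecaying {g₀ : ℝ → ℝ} {ν : ℝ} (hg : IsTimeProfile g₀ ν)
    (k : ℕ) : ∃ C, IsExpDecaying (iteratedDerivWithin k g₀ (Ici 0)) ν C := by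
  obtain ⟨C, hC⟩ := hg.decay k
  exact ⟨C, hg.smooth.continuousOn_iteratedDerivWithin (by exact_mod_cast le_top)
    (uniqueDiffOn_Ici 0), hC⟩

theorem IsTimeProfile.hasDerivWithinAt {g₀ : ℝ → ℝ} {ν : ℝ} (hg : IsTimeProfile g₀ ν)
    (k : ℕ) (τ : ℝ) (hτ : 0 ≤ τ) : HasDerivWithinAt (iteratedDerivWithin k g₀ (Ici 0))
      (iteratedDerivWithin (k + 1) g₀ (Ici 0) τ) (Ici 0) τ := by
  rw [iteratedDerivWithin_succ]
  exact (hg.smooth.differentiableOn_iteratedDerivWithin (by exact_mod_cast WithTop.coe_lt_top _)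
    (uniqueDiffOn_Ici 0) τ hτ).hasDerivWithinAt

/-! ### Smooth functions that are constant near infinity -/

section Distributions

open scoped SchwartzMap FourierTransform Laplacian

/-- Smooth real functions on the plane that are constant for large `|x|`. These are the
coefficients of the operator; they are bounded multipliers of tempered distributions. -/
structure IsStabilizing (a : Plane → ℝ) : Prop where
  smooth : ContDiff ℝ ∞ a
  compactSupport : ∃ b : ℝ, HasCompactSupport fun x => a x - b

/-- The standard basis vectors of the plane. -/
abbrev planeBasis (i : Fin 2) : Plane := EuclideanSpace.single i (1 : ℝ)

namespace IsStabilizing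

variable {a : Plane → ℝ}

theorem of_eq_const (h : ContDiff ℝ ∞ a) {R b : ℝ} (hR : ∀ x, R < ‖x‖ → a x = b) :
    IsStabilizing a := by
  refine ⟨h, b, HasCompactSupport.intro (isCompact_closedBall (0 : Plane) R) fun x hx => ?_⟩
  rw [hR x (by simpa using hx), sub_self]

theorem exists_bound (ha : IsStabilizing a) : ∃ M, 0 ≤ M ∧ ∀ x, |a x| ≤ M := by
  obtain ⟨b, hb⟩ := ha.compactSupport
  obtain ⟨M, hM⟩ := hb.exists_bound_of_continuous (ha.smooth.continuous.sub continuous_const)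
  have hM0 : 0 ≤ M := (norm_nonneg _).trans (hM 0)
  refine ⟨M + |b|, by positivity, fun x => ?_⟩
  have := abs_add_le (a x - b) b
  rw [sub_add_cancel] at this
  exact this.trans (add_le_add (hM x) le_rfl)

theorem hasTemperateGrowth (ha : IsStabilizing a) :
    (fun x => (a x : ℂ)).HasTemperateGrowth := by
  obtain ⟨b, hb⟩ := ha.compactSupport
  have h1 : (fun x => a x - b).HasTemperateGrowth :=
    hb.hasTemperateGrowth (ha.smooth.sub contDiff_const)
  have h2 := h1.add (Function.HasTemperateGrowth.const b)
  have h3 : a = (fun x => a x - b) + fun _ => b := by ext x; simp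
  rw [← h3] at h2
  fun_prop

theorem memLp_top (ha : IsStabilizing a) : MemLp (fun x => (a x : ℂ)) ⊤ volume := by
  obtain ⟨M, -, hM⟩ := ha.exists_bound
  refine memLp_top_of_bound
    (Complex.continuous_ofReal.comp ha.smooth.continuous).aestronglyMeasurable M ?_
  filter_upwards with x
  simpa using hM x

theorem pderiv (ha : IsStabilizing a) (i : Fin 2) :
    IsStabilizing fun x => fderiv ℝ a x (planeBasis i) := by
  obtain ⟨b, hb⟩ := ha.compactSupport
  refine ⟨(ha.smooth.fderiv_right (by simp)).clm_apply contDiff_const, 0, ?_⟩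
  have := hb.fderiv_apply (𝕜 := ℝ) (planeBasis i)
  simpa [fderiv_sub_const] using this

/-- Multiplication by a stabilizing function in `L²`. -/
def mulL2 (ha : IsStabilizing a) (u : PlaneL2) : PlaneL2 := ha.memLp_top.toLp _ • u

theorem coeFn_mulL2 (ha : IsStabilizing a) (u : PlaneL2) :
    ha.mulL2 u =ᵐ[volume] fun x => (a x : ℂ) * u x := by
  filter_upwards [Lp.coeFn_lpSMul (r := 2) (ha.memLp_top.toLp _) u, ha.memLp_top.coeFn_toLp]
    with x h1 h2
  rw [mulL2, h1, Pi.smul_apply', h2, smul_eq_mul]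

theorem coe_mulL2 (ha : IsStabilizing a) (u : PlaneL2) :
    (ha.mulL2 u : 𝓢'(Plane, ℂ)) =
      TemperedDistribution.smulLeftCLM ℂ (fun x => (a x : ℂ)) (u : 𝓢'(Plane, ℂ)) :=
  Lp.toTemperedDistribution_smul_eq ha.hasTemperateGrowth ha.memLp_top u

theorem norm_mulL2_le (ha : IsStabilizing a) {M : ℝ} (hM : ∀ x, |a x| ≤ M) (u : PlaneL2) :
    ‖ha.mulL2 u‖ ≤ M * ‖u‖ := by
  refine Lp.norm_le_mul_norm_of_ae_le_mul ?_
  filter_upwards [ha.coeFn_mulL2 u] with x hx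
  rw [hx, norm_mul, Complex.norm_real, Real.norm_eq_abs]
  gcongr
  exact hM x

theorem inner_mulL2 (ha : IsStabilizing a) (u w : PlaneL2) :
    inner ℂ (ha.mulL2 u) w = inner ℂ u (ha.mulL2 w) := by
  rw [L2.inner_def, L2.inner_def]
  refine integral_congr_ae ?_
  filter_upwards [ha.coeFn_mulL2 u, ha.coeFn_mulL2 w] with x h1 h2
  rw [h1, h2]
  simp only [RCLike.inner_apply, map_mul, Complex.conj_ofReal]
  ring

end IsStabilizing

/-! ### Distributional derivatives in `L²` -/

/-- A function in `L²` is determined by the distribution it defines. -/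
theorem planeL2_ext {u w : PlaneL2} (h : (u : 𝓢'(Plane, ℂ)) = w) : u = w := by
  have h0 : u - w ∈ (Lp.toTemperedDistributionCLM ℂ (volume : Measure Plane) 2).ker := by
    rw [LinearMap.mem_ker, map_sub, sub_eq_zero]
    exact h
  rw [Lp.ker_toTemperedDistributionCLM_eq_bot] at h0
  exact sub_eq_zero.1 h0

/-- The product rule `∂_i (a T) = a ∂_i T + (∂_i a) T`. -/
theorem distPartial_smulLeftCLM {a : Plane → ℝ} (ha : IsStabilizing a) (i : Fin 2)
    (T : 𝓢'(Plane, ℂ)) :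
    distPartial i (TemperedDistribution.smulLeftCLM ℂ (fun x => (a x : ℂ)) T) =
      TemperedDistribution.smulLeftCLM ℂ (fun x => (a x : ℂ)) (distPartial i T) +
      TemperedDistribution.smulLeftCLM ℂ
        (fun x => ((fderiv ℝ a x (planeBasis i) : ℝ) : ℂ)) T := by
  ext φ
  have ht := ha.hasTemperateGrowth
  have ht' := (ha.pderiv i).hasTemperateGrowth
  have key : ∂_{planeBasis i} (SchwartzMap.smulLeftCLM ℂ (fun x => (a x : ℂ)) φ) =
      SchwartzMap.smulLeftCLM ℂ (fun x => ((fderiv ℝ a x (planeBasis i) : ℝ) : ℂ)) φ +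
      SchwartzMap.smulLeftCLM ℂ (fun x => (a x : ℂ)) (∂_{planeBasis i} φ) := by
    ext x
    have hda : HasFDerivAt (fun x => (a x : ℂ)) (Complex.ofRealCLM ∘L fderiv ℝ a x) x :=
      Complex.ofRealCLM.hasFDerivAt.comp x
        ((ha.smooth.differentiable (by simp)) x).hasFDerivAt
    have h1 : HasFDerivAt (fun x => (a x : ℂ) * φ x) _ x := hda.mul (φ.hasFDerivAt x)
    have h2 : (⇑(SchwartzMap.smulLeftCLM ℂ (fun x => (a x : ℂ)) φ) : Plane → ℂ) =
        fun x => (a x : ℂ) * φ x := by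
      ext y; rw [SchwartzMap.smulLeftCLM_apply_apply ht, smul_eq_mul]
    rw [SchwartzMap.lineDerivOp_apply_eq_fderiv, h2, h1.fderiv]
    simp only [add_apply, SchwartzMap.smulLeftCLM_apply_apply ht,
      SchwartzMap.smulLeftCLM_apply_apply ht', SchwartzMap.lineDerivOp_apply_eq_fderiv]
    simp
    ring
  change T (SchwartzMap.smulLeftCLM ℂ (fun x => (a x : ℂ)) (-∂_{planeBasis i} φ)) =
    T (-∂_{planeBasis i} (SchwartzMap.smulLeftCLM ℂ (fun x => (a x : ℂ)) φ)) +
    T (SchwartzMap.smulLeftCLM ℂ (fun x => ((fderiv ℝ a x (planeBasis i) : ℝ) : ℂ)) φ)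
  rw [key, ← map_add, map_neg]
  congr 1
  abel

/-- On the Fourier side `∂_i` is multiplication by `2 π i ξ_i`. -/
theorem fourier_ae_eq_of_distPartial_eq {i : Fin 2} {u w : PlaneL2}
    (h : distPartial i (u : 𝓢'(Plane, ℂ)) = w) :
    ∀ᵐ ξ : Plane, (𝓕 w : PlaneL2) ξ =
      (2 * Real.pi * Complex.I) * ((inner ℝ ξ (planeBasis i) : ℝ) : ℂ) * (𝓕 u : PlaneL2) ξ := by
  have h1 : ((𝓕 w : PlaneL2) : 𝓢'(Plane, ℂ)) = (2 * Real.pi * Complex.I) •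
      TemperedDistribution.smulLeftCLM ℂ (fun ξ : Plane => ((inner ℝ ξ (planeBasis i) : ℝ) : ℂ))
        ((𝓕 u : PlaneL2) : 𝓢'(Plane, ℂ)) := by
    rw [← Lp.fourier_toTemperedDistribution_eq, ← h, ← Lp.fourier_toTemperedDistribution_eq]
    exact TemperedDistribution.fourier_lineDerivOp_eq _ _
  have hloc : ∀ f : PlaneL2, LocallyIntegrable f volume := fun f =>
    (Lp.memLp f).locallyIntegrable (by norm_num)
  have hcont : Continuous fun ξ : Plane =>
      (2 * Real.pi * Complex.I) * ((inner ℝ ξ (planeBasis i) : ℝ) : ℂ) := by fun_prop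
  have hloc' : LocallyIntegrable (fun ξ : Plane =>
      (2 * Real.pi * Complex.I) * ((inner ℝ ξ (planeBasis i) : ℝ) : ℂ) *
        (𝓕 u : PlaneL2) ξ) volume := by
    have := (locallyIntegrableOn_univ.2 (hloc (𝓕 u : PlaneL2))).continuousOn_mul
      hcont.continuousOn isClosed_univ.isLocallyClosed
    exact locallyIntegrableOn_univ.1 this
  refine ae_eq_of_integral_contDiff_smul_eq (hloc _) hloc' fun g hg hgc => ?_
  have hg₁ : HasCompactSupport (Complex.ofRealCLM ∘ g) := hgc.comp_left rfl
  have hg₂ : ContDiff ℝ ∞ (Complex.ofRealCLM ∘ g) := by fun_prop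
  have h2 := DFunLike.congr_fun h1 (hg₁.toSchwartzMap hg₂)
  have ht : (fun ξ : Plane => ((inner ℝ ξ (planeBasis i) : ℝ) : ℂ)).HasTemperateGrowth := by
    fun_prop
  rw [Lp.toTemperedDistribution_apply] at h2
  change _ = (2 * Real.pi * Complex.I) • ((𝓕 u : PlaneL2) : 𝓢'(Plane, ℂ))
    (SchwartzMap.smulLeftCLM ℂ _ (hg₁.toSchwartzMap hg₂)) at h2
  rw [Lp.toTemperedDistribution_apply, ← integral_smul] at h2
  refine (Eq.trans ?_ h2).trans ?_
  · refine integral_congr_ae (Filter.Eventually.of_forall fun ξ => ?_)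
    simp
  · refine integral_congr_ae (Filter.Eventually.of_forall fun ξ => ?_)
    simp only [SchwartzMap.smulLeftCLM_apply_apply ht]
    simp
    ring

/-- Integration by parts: by Plancherel's theorem it reduces to the fact that the multiplier
`2 π i ξ_i` is purely imaginary. -/
theorem inner_distPartial_left {i : Fin 2} {u w u' w' : PlaneL2}
    (h : distPartial i (u : 𝓢'(Plane, ℂ)) = w) (h' : distPartial i (u' : 𝓢'(Plane, ℂ)) = w') :
    inner ℂ w u' = -inner ℂ u w' := by
  rw [← Lp.inner_fourier_eq w u', ← Lp.inner_fourier_eq u w', L2.inner_def, L2.inner_def,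
    ← integral_neg]
  refine integral_congr_ae ?_
  filter_upwards [fourier_ae_eq_of_distPartial_eq h, fourier_ae_eq_of_distPartial_eq h']
    with ξ h1 h2
  rw [h1, h2]
  simp only [RCLike.inner_apply, map_mul, Complex.conj_ofReal, Complex.conj_I, map_ofNat]
  ring

/-! ### Sobolev spaces of orders one and two -/

theorem laplacian_eq_sum_distPartial (T : 𝓢'(Plane, ℂ)) :
    Δ T = ∑ i, distPartial i (distPartial i T) := by
  rw [TemperedDistribution.laplacian_eq_sum (EuclideanSpace.basisFun (Fin 2) ℝ)]
  simp [distPartial]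

theorem besselPotential_two (T : 𝓢'(Plane, ℂ)) :
    TemperedDistribution.besselPotential Plane ℂ 2 T = T - ((2 * Real.pi : ℂ) ^ 2)⁻¹ • Δ T := by
  have h0 : (2 * Real.pi : ℂ) ^ 2 ≠ 0 := by simp [Real.pi_ne_zero]
  have h2 : ((-(2 * Real.pi) ^ 2 : ℝ) : ℂ) = -(2 * Real.pi : ℂ) ^ 2 := by push_cast; ring
  rw [TemperedDistribution.laplacian_eq_fourierMultiplierCLM, ← Complex.coe_smul (-(2 * _) ^ 2),
    h2, smul_smul, mul_neg, inv_mul_cancel₀ h0, neg_one_smul, sub_neg_eq_add,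
    TemperedDistribution.besselPotential]
  have h1 : (fun x : Plane => (((1 + ‖x‖ ^ 2) ^ ((2 : ℝ) / 2) : ℝ) : ℂ)) =
      (fun _ => (1 : ℂ)) + fun x => ((‖x‖ ^ 2 : ℝ) : ℂ) := by
    ext x
    simp
  have ht : (fun x : Plane => ((‖x‖ ^ 2 : ℝ) : ℂ)).HasTemperateGrowth := by fun_prop
  rw [h1]
  simp only [TemperedDistribution.fourierMultiplierCLM_apply]
  rw [TemperedDistribution.smulLeftCLM_add (by fun_prop) ht]
  simp [FourierTransform.fourierInv_add]

theorem inSobolev_two_iff_laplacian (u : PlaneL2) :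
    InSobolev 2 u ↔ ∃ w : PlaneL2, Δ (u : 𝓢'(Plane, ℂ)) = w := by
  have h0 : (2 * Real.pi : ℂ) ^ 2 ≠ 0 := by simp [Real.pi_ne_zero]
  rw [InSobolev, TemperedDistribution.MemSobolev]
  simp only [besselPotential_two, ← Lp.toTemperedDistributionCLM_apply]
  constructor
  · rintro ⟨f, hf⟩
    refine ⟨((2 * Real.pi : ℂ) ^ 2) • (u - f), ?_⟩
    rw [map_smul, map_sub, ← hf, sub_sub_cancel, smul_smul, mul_inv_cancel₀ h0, one_smul]
  · rintro ⟨w, hw⟩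
    exact ⟨u - ((2 * Real.pi : ℂ) ^ 2)⁻¹ • w, by rw [map_sub, map_smul, hw]⟩

/-- If the first derivatives of `u` are in `L²`, then `u - (2π)⁻² Δu` is in `H⁻¹`, and it is the
Bessel potential of order two of `u`. -/
theorem inSobolev_one_of_distPartial {u : PlaneL2}
    (h : ∀ i, ∃ w : PlaneL2, distPartial i (u : 𝓢'(Plane, ℂ)) = w) : InSobolev 1 u := by
  rw [InSobolev, show (1 : ℝ) = 2 + (-1) by norm_num,
    ← TemperedDistribution.memSobolev_besselPotential_iff, besselPotential_two,
    laplacian_eq_sum_distPartial]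
  have h1 : TemperedDistribution.MemSobolev (-1) 2 (u : 𝓢'(Plane, ℂ)) :=
    (TemperedDistribution.memSobolev_zero_iff.2 ⟨u, rfl⟩).mono (by norm_num)
  have h2 : ∀ i, TemperedDistribution.MemSobolev (-1) 2
      (distPartial i (distPartial i (u : 𝓢'(Plane, ℂ)))) := fun i => by
    obtain ⟨w, hw⟩ := h i
    have := (TemperedDistribution.memSobolev_zero_iff.2 ⟨w, hw⟩).lineDerivOp (m := planeBasis i)
    simpa [distPartial] using this
  refine h1.sub ?_
  rw [Fin.sum_univ_two]
  exact ((h2 0).add (h2 1)).smul _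

theorem exists_distPartial_of_inSobolev_two {u : PlaneL2} (h : InSobolev 2 u) (i : Fin 2) :
    ∃ w : PlaneL2, distPartial i (u : 𝓢'(Plane, ℂ)) = w := by
  have := (TemperedDistribution.MemSobolev.lineDerivOp (m := planeBasis i) h).mono
    (s' := 0) (by norm_num)
  exact TemperedDistribution.memSobolev_zero_iff.1 this

theorem exists_distPartial_distPartial_of_inSobolev_two {u : PlaneL2} (h : InSobolev 2 u)
    (i j : Fin 2) : ∃ w : PlaneL2, distPartial j (distPartial i (u : 𝓢'(Plane, ℂ))) = w := by
  have := (TemperedDistribution.MemSobolev.lineDerivOp (m := planeBasis j)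
    (TemperedDistribution.MemSobolev.lineDerivOp (m := planeBasis i) h)).mono
    (s' := 0) (by norm_num)
  exact TemperedDistribution.memSobolev_zero_iff.1 this

theorem weakPartial_eq {i : Fin 2} {u w : PlaneL2}
    (h : distPartial i (u : 𝓢'(Plane, ℂ)) = w) : weakPartial i u = w := by
  have hex : ∃ w : PlaneL2, distPartial i (u : 𝓢'(Plane, ℂ)) = w := ⟨w, h⟩
  rw [weakPartial, dif_pos hex]
  exact planeL2_ext (hex.choose_spec.symm.trans h)

end Distributions

section WaveOperator

open scoped SchwartzMap FourierTransform Laplacian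

/-! ### The coefficients of the wave operator -/

namespace IsVelocity

variable {c : Plane → ℝ}

/-- A smooth function of the velocity is again constant for large `|x|`. -/
theorem isStabilizing_comp (hc : IsVelocity c) {F : ℝ → ℝ}
    (hF : ContDiff ℝ ∞ fun x => F (c x)) : IsStabilizing fun x => F (c x) := by
  obtain ⟨R, b, hR⟩ := hc.stabilizes
  exact .of_eq_const hF (R := R) (b := F b) fun x hx => by rw [hR x hx]

theorem isStabilizing (hc : IsVelocity c) : IsStabilizing c :=
  hc.isStabilizing_comp (F := fun r => r) hc.smooth

theorem isStabilizing_inv (hc : IsVelocity c) : IsStabilizing fun x => (c x)⁻¹ :=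
  hc.isStabilizing_comp (F := fun r => r⁻¹) (hc.smooth.inv fun x => (hc.pos x).ne')

theorem isStabilizing_sq (hc : IsVelocity c) : IsStabilizing fun x => c x ^ 2 :=
  hc.isStabilizing_comp (F := fun r => r ^ 2) (hc.smooth.pow 2)

theorem isStabilizing_sq_inv (hc : IsVelocity c) : IsStabilizing fun x => (c x ^ 2)⁻¹ :=
  hc.isStabilizing_comp (F := fun r => (r ^ 2)⁻¹)
    ((hc.smooth.pow 2).inv fun x => pow_ne_zero 2 (hc.pos x).ne')

end IsVelocity

theorem IsStabilizing.smulLeftCLM_smulLeftCLM {a b d : Plane → ℝ} (ha : IsStabilizing a)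
    (hb : IsStabilizing b) (h : ∀ x, b x * a x = d x) (T : 𝓢'(Plane, ℂ)) :
    TemperedDistribution.smulLeftCLM ℂ (fun x => (a x : ℂ))
      (TemperedDistribution.smulLeftCLM ℂ (fun x => (b x : ℂ)) T) =
    TemperedDistribution.smulLeftCLM ℂ (fun x => (d x : ℂ)) T := by
  rw [TemperedDistribution.smulLeftCLM_smulLeftCLM_apply hb.hasTemperateGrowth
    ha.hasTemperateGrowth]
  congr 2
  ext x
  rw [← h x]
  simp

theorem IsStabilizing.smulLeftCLM_smulLeftCLM_of_inv {a b : Plane → ℝ} (ha : IsStabilizing a)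
    (hb : IsStabilizing b) (h : ∀ x, b x * a x = 1) (T : 𝓢'(Plane, ℂ)) :
    TemperedDistribution.smulLeftCLM ℂ (fun x => (a x : ℂ))
      (TemperedDistribution.smulLeftCLM ℂ (fun x => (b x : ℂ)) T) = T := by
  rw [ha.smulLeftCLM_smulLeftCLM hb (d := fun _ => 1) h]
  simp

/-! ### The divergence form on `H²` -/

theorem coe_planeL2_zero : ((0 : PlaneL2) : 𝓢'(Plane, ℂ)) = 0 := by
  rw [← Lp.toTemperedDistributionCLM_apply, map_zero]

theorem distPartial_zero (i : Fin 2) : distPartial i (0 : 𝓢'(Plane, ℂ)) = 0 := by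
  have h := distPartial_add i 0 0
  rw [add_zero] at h
  exact left_eq_add.1 h

theorem distPartial_apply (i : Fin 2) (T : 𝓢'(Plane, ℂ)) (φ : 𝓢(Plane, ℂ)) :
    distPartial i T φ = -T (∂_{planeBasis i} φ) := by
  change T (-∂_{planeBasis i} φ) = _
  rw [map_neg]

/-- The divergence form expanded by the product rule: `-(c² Δ T + ∑ (∂_i c²) ∂_i T)`. -/
theorem divForm_eq {c : Plane → ℝ} (hc : IsVelocity c) (T : 𝓢'(Plane, ℂ)) :
    divForm c T = -(TemperedDistribution.smulLeftCLM ℂ (fun x => ((c x ^ 2 : ℝ) : ℂ)) (Δ T) +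
      ∑ i, TemperedDistribution.smulLeftCLM ℂ
        (fun x => ((fderiv ℝ (fun x => c x ^ 2) x (planeBasis i) : ℝ) : ℂ))
          (distPartial i T)) := by
  simp only [divForm, distPartial_smulLeftCLM hc.isStabilizing_sq, Finset.sum_add_distrib,
    laplacian_eq_sum_distPartial, map_sum]

theorem exists_coe_eq_sum {ι : Type*} (s : Finset ι) {T : ι → 𝓢'(Plane, ℂ)}
    (h : ∀ i, ∃ w : PlaneL2, T i = w) : ∃ w : PlaneL2, ∑ i ∈ s, T i = w := by
  choose w hw using h
  refine ⟨∑ i ∈ s, w i, ?_⟩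
  rw [← Lp.toTemperedDistributionCLM_apply, map_sum]
  exact Finset.sum_congr rfl fun i _ => hw i

/-- The first order part `∑ (∂_i c²) ∂_i T` of the divergence form is in `L²` when `∇T` is. -/
theorem exists_coe_eq_lower_order {c : Plane → ℝ} (hc : IsVelocity c) {T : 𝓢'(Plane, ℂ)}
    (h : ∀ i, ∃ w : PlaneL2, distPartial i T = w) :
    ∃ w : PlaneL2, ∑ i, TemperedDistribution.smulLeftCLM ℂ
        (fun x => ((fderiv ℝ (fun x => c x ^ 2) x (planeBasis i) : ℝ) : ℂ))
          (distPartial i T) = w := by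
  refine exists_coe_eq_sum _ fun i => ?_
  obtain ⟨w, hw⟩ := h i
  exact ⟨(hc.isStabilizing_sq.pderiv i).mulL2 w, by rw [IsStabilizing.coe_mulL2, hw]⟩

/-- Elliptic regularity: as the leading coefficient is a scalar, the equation expresses the
Laplacian of `u` through first derivatives of `u` and the right-hand side. -/
theorem inSobolev_two_of_divForm {c : Plane → ℝ} (hc : IsVelocity c) {u f : PlaneL2}
    (h : ∀ i, ∃ w : PlaneL2, distPartial i (u : 𝓢'(Plane, ℂ)) = w)
    (hf : divForm c (u : 𝓢'(Plane, ℂ)) = f) : InSobolev 2 u := by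
  rw [inSobolev_two_iff_laplacian]
  obtain ⟨w, hw⟩ := exists_coe_eq_lower_order hc h
  rw [divForm_eq hc, hw] at hf
  refine ⟨hc.isStabilizing_sq_inv.mulL2 (-(f + w)), ?_⟩
  rw [IsStabilizing.coe_mulL2]
  have h1 : ((-(f + w) : PlaneL2) : 𝓢'(Plane, ℂ)) =
      TemperedDistribution.smulLeftCLM ℂ (fun x => ((c x ^ 2 : ℝ) : ℂ))
        (Δ (u : 𝓢'(Plane, ℂ))) := by
    rw [← Lp.toTemperedDistributionCLM_apply, map_neg, map_add,
      Lp.toTemperedDistributionCLM_apply, Lp.toTemperedDistributionCLM_apply, ← hf]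
    abel
  rw [h1, hc.isStabilizing_sq_inv.smulLeftCLM_smulLeftCLM_of_inv hc.isStabilizing_sq]
  exact fun x => mul_inv_cancel₀ (pow_ne_zero 2 (hc.pos x).ne')

theorem exists_divForm_eq_of_inSobolev_two {c : Plane → ℝ} (hc : IsVelocity c) {u : PlaneL2}
    (hu : InSobolev 2 u) : ∃ f : PlaneL2, divForm c (u : 𝓢'(Plane, ℂ)) = f := by
  obtain ⟨w, hw⟩ := exists_coe_eq_lower_order hc (exists_distPartial_of_inSobolev_two hu)
  obtain ⟨v, hv⟩ := (inSobolev_two_iff_laplacian u).1 hu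
  refine ⟨-(hc.isStabilizing_sq.mulL2 v + w), ?_⟩
  rw [divForm_eq hc, hw, hv, ← IsStabilizing.coe_mulL2 hc.isStabilizing_sq,
    ← Lp.toTemperedDistributionCLM_apply, ← Lp.toTemperedDistributionCLM_apply,
    ← Lp.toTemperedDistributionCLM_apply, map_neg, map_add]

theorem waveGraph_functional (c : Plane → ℝ) :
    ∀ p ∈ waveGraph c, p.1 = 0 → p.2 = 0 := by
  rintro ⟨u, f⟩ ⟨-, hf⟩ hu
  simp only at hu hf
  subst hu
  apply planeL2_ext
  rw [hf]
  simp [divForm, coe_planeL2_zero, distPartial_zero]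

theorem waveOp_apply (c : Plane → ℝ) (u : (waveOp c).domain) :
    ((waveOp c u : PlaneL2) : 𝓢'(Plane, ℂ)) = divForm c ((u : PlaneL2) : 𝓢'(Plane, ℂ)) :=
  (Submodule.mem_graph_toLinearPMap (waveGraph_functional c) u).2

theorem mem_waveOp_domain_iff {c : Plane → ℝ} (hc : IsVelocity c) (u : PlaneL2) :
    u ∈ (waveOp c).domain ↔ InSobolev 2 u := by
  rw [waveOp, Submodule.toLinearPMap_domain, Submodule.mem_map]
  constructor
  · rintro ⟨⟨v, f⟩, ⟨hv, -⟩, rfl⟩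
    exact hv
  · intro hu
    obtain ⟨f, hf⟩ := exists_divForm_eq_of_inSobolev_two hc hu
    exact ⟨(u, f), ⟨hu, hf.symm⟩, rfl⟩

/-! ### The form domain -/

/-- The Hilbert space `L² ⊕ L² ⊕ L²`; the coordinate `none` holds a function and the coordinates
`some i` a vector field. -/
abbrev FieldSpace : Type := PiLp 2 fun _ : Option (Fin 2) => PlaneL2

/-- The form domain of `1 + L`, that is, `H¹` embedded in `L² ⊕ L² ⊕ L²` as the set of
triples `(u, c ∂₁ u, c ∂₂ u)`; the norm of the triple is `⟨(1 + L) u, u⟩ ^ (1/2)`. -/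
def formDomain (c : Plane → ℝ) : Submodule ℂ FieldSpace where
  carrier := {k | ∀ i, TemperedDistribution.smulLeftCLM ℂ (fun x => (c x : ℂ))
    (distPartial i (k none : 𝓢'(Plane, ℂ))) = k (some i)}
  zero_mem' := fun i => by
    simp only [PiLp.zero_apply, coe_planeL2_zero, distPartial_zero, map_zero]
  add_mem' := fun {k l} hk hl i => by
    have h : ∀ a b : PlaneL2, ((a + b : PlaneL2) : 𝓢'(Plane, ℂ)) = a + b := fun a b => by
      simp only [← Lp.toTemperedDistributionCLM_apply, map_add]
    simp only [PiLp.add_apply, h, distPartial_add, map_add, hk i, hl i]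
  smul_mem' := fun a k hk i => by
    have h : ∀ b : PlaneL2, ((a • b : PlaneL2) : 𝓢'(Plane, ℂ)) = a • (b : 𝓢'(Plane, ℂ)) :=
      fun b => by simp only [← Lp.toTemperedDistributionCLM_apply, map_smul]
    simp only [PiLp.smul_apply, h, distPartial_smul, map_smul, hk i]

theorem isClosed_formDomain (c : Plane → ℝ) : IsClosed (formDomain c : Set FieldSpace) := by
  have h : (formDomain c : Set FieldSpace) = ⋂ i, {k : FieldSpace |
      TemperedDistribution.smulLeftCLM ℂ (fun x => (c x : ℂ))
        (LineDeriv.lineDerivOpCLM ℂ 𝓢'(Plane, ℂ) (planeBasis i)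
          (Lp.toTemperedDistributionCLM ℂ volume 2 (k none))) =
      Lp.toTemperedDistributionCLM ℂ volume 2 (k (some i))} := by
    ext k
    simp only [mem_iInter]
    rfl
  rw [h]
  refine isClosed_iInter fun i => isClosed_eq ?_ ?_
  · refine (ContinuousLinearMap.continuous _).comp ((ContinuousLinearMap.continuous _).comp
      ((ContinuousLinearMap.continuous _).comp ?_))
    exact PiLp.continuous_apply 2 _ none
  · exact (ContinuousLinearMap.continuous _).comp (PiLp.continuous_apply 2 _ (some i))

instance (c : Plane → ℝ) : CompleteSpace (formDomain c) :=
  (isClosed_formDomain c).completeSpace_coe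

/-- The embedding of the form domain in `L²`. -/
def formEmbedding (c : Plane → ℝ) : formDomain c →L[ℂ] PlaneL2 :=
  PiLp.proj 2 (fun _ : Option (Fin 2) => PlaneL2) none ∘L (formDomain c).subtypeL

theorem formEmbedding_apply (c : Plane → ℝ) (k : formDomain c) :
    formEmbedding c k = (k : FieldSpace) none := rfl

theorem norm_formEmbedding_le (c : Plane → ℝ) : ‖formEmbedding c‖ ≤ 1 :=
  ContinuousLinearMap.opNorm_le_bound _ zero_le_one fun k => by
    rw [one_mul, formEmbedding_apply]
    exact PiLp.norm_apply_le (k : FieldSpace) none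

theorem formEmbedding_injective (c : Plane → ℝ) : Function.Injective (formEmbedding c) := by
  rw [injective_iff_map_eq_zero]
  intro k hk
  have h0 : (k : FieldSpace) none = 0 := hk
  apply Subtype.ext
  apply PiLp.ext
  intro j
  rcases j with _ | i
  · exact h0
  · apply planeL2_ext
    rw [← k.2 i, h0]
    simp [coe_planeL2_zero, distPartial_zero]

/-- Constructor for elements of the form domain from a function and its weak derivatives. -/
def formElement {c : Plane → ℝ} (hc : IsVelocity c) {u : PlaneL2} {w : Fin 2 → PlaneL2}
    (h : ∀ i, distPartial i (u : 𝓢'(Plane, ℂ)) = w i) : formDomain c :=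
  ⟨WithLp.toLp 2 fun j => j.elim u fun i => hc.isStabilizing.mulL2 (w i), fun i => by
    simp [IsStabilizing.coe_mulL2, h i]⟩

theorem formElement_none {c : Plane → ℝ} (hc : IsVelocity c) {u : PlaneL2}
    {w : Fin 2 → PlaneL2} (h : ∀ i, distPartial i (u : 𝓢'(Plane, ℂ)) = w i) :
    (formElement hc h : FieldSpace) none = u := rfl

theorem formElement_some {c : Plane → ℝ} (hc : IsVelocity c) {u : PlaneL2}
    {w : Fin 2 → PlaneL2} (h : ∀ i, distPartial i (u : 𝓢'(Plane, ℂ)) = w i) (i : Fin 2) :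
    (formElement hc h : FieldSpace) (some i) = hc.isStabilizing.mulL2 (w i) := rfl

theorem distPartial_formEmbedding {c : Plane → ℝ} (hc : IsVelocity c) (k : formDomain c)
    (i : Fin 2) : distPartial i (formEmbedding c k : 𝓢'(Plane, ℂ)) =
      hc.isStabilizing_inv.mulL2 ((k : FieldSpace) (some i)) := by
  rw [IsStabilizing.coe_mulL2, ← k.2 i,
    hc.isStabilizing_inv.smulLeftCLM_smulLeftCLM_of_inv hc.isStabilizing]
  · rfl
  · exact fun x => mul_inv_cancel₀ (hc.pos x).ne'

theorem inner_formDomain {c : Plane → ℝ} (k l : formDomain c) :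
    inner ℂ k l = inner ℂ ((k : FieldSpace) none) ((l : FieldSpace) none) +
      ∑ i, inner ℂ ((k : FieldSpace) (some i)) ((l : FieldSpace) (some i)) := by
  rw [Submodule.coe_inner, PiLp.inner_apply, Fintype.sum_option]

/-! ### The resolvent of the wave operator -/

/-- The complex conjugate of a Schwartz function. -/
def schwartzConj (φ : 𝓢(Plane, ℂ)) : 𝓢(Plane, ℂ) :=
  SchwartzMap.postcompCLM (𝕜 := ℝ) (Complex.conjCLE : ℂ →L[ℝ] ℂ) φ

theorem schwartzConj_apply (φ : 𝓢(Plane, ℂ)) (x : Plane) :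
    schwartzConj φ x = (starRingEnd ℂ) (φ x) := rfl

theorem lineDerivOp_schwartzConj (φ : 𝓢(Plane, ℂ)) (m : Plane) :
    ∂_{m} (schwartzConj φ) = schwartzConj (∂_{m} φ) := by
  ext x
  have h : HasFDerivAt (schwartzConj φ)
      ((Complex.conjCLE : ℂ →L[ℝ] ℂ) ∘L fderiv ℝ φ x) x :=
    (Complex.conjCLE : ℂ →L[ℝ] ℂ).hasFDerivAt.comp x (φ.hasFDerivAt x)
  rw [SchwartzMap.lineDerivOp_apply_eq_fderiv, h.fderiv, schwartzConj_apply,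
    SchwartzMap.lineDerivOp_apply_eq_fderiv]
  rfl

theorem inner_toLp_schwartzConj (φ : 𝓢(Plane, ℂ)) (f : PlaneL2) :
    inner ℂ ((schwartzConj φ).toLp 2 : PlaneL2) f = (f : 𝓢'(Plane, ℂ)) φ := by
  rw [L2.inner_def, Lp.toTemperedDistribution_apply]
  refine integral_congr_ae ?_
  filter_upwards [(schwartzConj φ).coeFn_toLp 2 volume] with x hx
  rw [hx, schwartzConj_apply]
  simp [mul_comm]

theorem distPartial_toLp_schwartzConj (φ : 𝓢(Plane, ℂ)) (i : Fin 2) :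
    distPartial i (((schwartzConj φ).toLp 2 : PlaneL2) : 𝓢'(Plane, ℂ)) =
      ((schwartzConj (∂_{planeBasis i} φ)).toLp 2 : PlaneL2) := by
  rw [Lp.toTemperedDistribution_toLp_eq, Lp.toTemperedDistribution_toLp_eq, distPartial,
    TemperedDistribution.lineDerivOp_toTemperedDistributionCLM_eq, lineDerivOp_schwartzConj]

open ContinuousLinearMap (adjoint)

theorem inner_adjoint_formEmbedding {c : Plane → ℝ} (k : formDomain c) (f : PlaneL2) :
    inner ℂ k (adjoint (formEmbedding c) f) = inner ℂ ((k : FieldSpace) none) f := by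
  rw [ContinuousLinearMap.adjoint_inner_right]
  rfl

/-- The function `u = J J* f` is the weak solution of `u + L u = f`. -/
theorem formResolvent_weak_solution {c : Plane → ℝ} (hc : IsVelocity c) (f : PlaneL2) :
    (f : 𝓢'(Plane, ℂ)) = (formResolvent (formEmbedding c) f : 𝓢'(Plane, ℂ)) +
      divForm c (formResolvent (formEmbedding c) f : 𝓢'(Plane, ℂ)) := by
  set k := adjoint (formEmbedding c) f with hk
  change _ = (((k : FieldSpace) none : PlaneL2) : 𝓢'(Plane, ℂ)) +
    divForm c (((k : FieldSpace) none : PlaneL2) : 𝓢'(Plane, ℂ))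
  ext φ
  -- The defining identity of `J* f` is tested on the element of `K` given by the conjugate of `φ`,
  -- since the inner product is antilinear in its first argument.
  have h1 := inner_adjoint_formEmbedding (formElement hc (distPartial_toLp_schwartzConj φ)) f
  rw [← hk, inner_formDomain] at h1
  simp only [formElement_none, formElement_some, IsStabilizing.inner_mulL2,
    inner_toLp_schwartzConj] at h1
  have h2 : ∀ i, (hc.isStabilizing.mulL2 ((k : FieldSpace) (some i)) : 𝓢'(Plane, ℂ)) =
      TemperedDistribution.smulLeftCLM ℂ (fun x => ((c x ^ 2 : ℝ) : ℂ))
        (distPartial i (((k : FieldSpace) none : PlaneL2) : 𝓢'(Plane, ℂ))) := fun i => by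
    rw [IsStabilizing.coe_mulL2, ← k.2 i]
    exact hc.isStabilizing.smulLeftCLM_smulLeftCLM hc.isStabilizing (fun x => (sq (c x)).symm) _
  simp only [h2] at h1
  rw [← h1]
  simp only [divForm, add_apply, neg_apply, sum_apply, distPartial_apply, Finset.sum_neg_distrib,
    neg_neg]

theorem exists_distPartial_formResolvent {c : Plane → ℝ} (hc : IsVelocity c) (f : PlaneL2)
    (i : Fin 2) : ∃ w : PlaneL2,
      distPartial i (formResolvent (formEmbedding c) f : 𝓢'(Plane, ℂ)) = w :=
  ⟨_, distPartial_formEmbedding hc (adjoint (formEmbedding c) f) i⟩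

/-- `J J*` is the inverse of `1 + L`. -/
theorem isInverseOneAdd_formResolvent {c : Plane → ℝ} (hc : IsVelocity c) :
    IsInverseOneAdd (waveOp c) (formResolvent (formEmbedding c)) := by
  constructor
  · intro f
    have h1 := formResolvent_weak_solution hc f
    set u := formResolvent (formEmbedding c) f
    have h2 : divForm c (u : 𝓢'(Plane, ℂ)) = ((f - u : PlaneL2) : 𝓢'(Plane, ℂ)) := by
      rw [← Lp.toTemperedDistributionCLM_apply (f - u), map_sub,
        Lp.toTemperedDistributionCLM_apply, Lp.toTemperedDistributionCLM_apply, h1]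
      abel
    have hu : u ∈ (waveOp c).domain := (mem_waveOp_domain_iff hc u).2
      (inSobolev_two_of_divForm hc (exists_distPartial_formResolvent hc f) h2)
    refine ⟨hu, ?_⟩
    have h3 : waveOp c ⟨u, hu⟩ = f - u := planeL2_ext ((waveOp_apply c ⟨u, hu⟩).trans h2)
    rw [h3, add_sub_cancel]
  · intro u
    have hu := (mem_waveOp_domain_iff hc (u : PlaneL2)).1 u.2
    choose w hw using exists_distPartial_of_inSobolev_two hu
    choose w' hw' using fun i => exists_distPartial_distPartial_of_inSobolev_two hu i i
    set k := formElement hc hw with hk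
    set z : Fin 2 → PlaneL2 := fun i => hc.isStabilizing_sq.mulL2 (w' i) +
      (hc.isStabilizing_sq.pderiv i).mulL2 (w i)
    have hsq : ∀ i, (hc.isStabilizing.mulL2 (hc.isStabilizing.mulL2 (w i)) : 𝓢'(Plane, ℂ)) =
        TemperedDistribution.smulLeftCLM ℂ (fun x => ((c x ^ 2 : ℝ) : ℂ))
          (distPartial i ((u : PlaneL2) : 𝓢'(Plane, ℂ))) := fun i => by
      rw [IsStabilizing.coe_mulL2, IsStabilizing.coe_mulL2, hw i]
      exact hc.isStabilizing.smulLeftCLM_smulLeftCLM hc.isStabilizing (fun x => (sq (c x)).symm) _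
    have hz : ∀ i, distPartial i
        (hc.isStabilizing.mulL2 (hc.isStabilizing.mulL2 (w i)) : 𝓢'(Plane, ℂ)) = z i := fun i => by
      rw [hsq, distPartial_smulLeftCLM hc.isStabilizing_sq, hw' i, hw i,
        ← hc.isStabilizing_sq.coe_mulL2, ← (hc.isStabilizing_sq.pderiv i).coe_mulL2,
        ← Lp.toTemperedDistributionCLM_apply, ← Lp.toTemperedDistributionCLM_apply, ← map_add]
      rfl
    have hwave : waveOp c u = -∑ i, z i := by
      apply planeL2_ext
      rw [waveOp_apply, ← Lp.toTemperedDistributionCLM_apply (-_), map_neg, map_sum, divForm]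
      congr 1
      refine Finset.sum_congr rfl fun i _ => ?_
      rw [← hsq i, hz i]
      rfl
    -- Integration by parts shows `⟨l, k⟩ = ⟨J l, u + L u⟩` for all `l` in the form domain.
    have key : adjoint (formEmbedding c) ((u : PlaneL2) + waveOp c u) = k := by
      refine ext_inner_left ℂ fun l => ?_
      rw [inner_adjoint_formEmbedding, inner_formDomain, inner_add_right, hk, formElement_none]
      congr 1
      rw [hwave, inner_neg_right, inner_sum, ← Finset.sum_neg_distrib]
      refine Finset.sum_congr rfl fun i _ => ?_
      have h1 : (l : FieldSpace) (some i) = hc.isStabilizing.mulL2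
          (hc.isStabilizing_inv.mulL2 ((l : FieldSpace) (some i))) := by
        apply planeL2_ext
        rw [IsStabilizing.coe_mulL2, IsStabilizing.coe_mulL2,
          hc.isStabilizing.smulLeftCLM_smulLeftCLM_of_inv hc.isStabilizing_inv]
        exact fun x => inv_mul_cancel₀ (hc.pos x).ne'
      rw [formElement_some, h1, IsStabilizing.inner_mulL2]
      exact (inner_distPartial_left (distPartial_formEmbedding hc l i) (hz i)).symm
    rw [formResolvent_apply, key]
    rfl

theorem invOneAdd_waveOp {c : Plane → ℝ} (hc : IsVelocity c) :
    invOneAdd (waveOp c) = formResolvent (formEmbedding c) :=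
  (isInverseOneAdd_formResolvent hc).invOneAdd_eq

theorem isSelfAdjoint_waveOp {c : Plane → ℝ} (hc : IsVelocity c) : IsSelfAdjoint (waveOp c) :=
  (isInverseOneAdd_formResolvent hc).isSelfAdjoint (isSelfAdjoint_formResolvent _)

theorem waveOp_nonneg {c : Plane → ℝ} (hc : IsVelocity c) (u : (waveOp c).domain) :
    0 ≤ (inner ℂ (u : PlaneL2) (waveOp c u)).re := by
  -- For `u = J J* f` this is `‖J* f‖² - ‖J J* f‖² ≥ 0`, as `J` is a contraction.
  have h := (isInverseOneAdd_formResolvent hc).2 u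
  set f := (u : PlaneL2) + waveOp c u
  have h1 : waveOp c u = f - u := by simp [f]
  have h2 : inner ℂ (u : PlaneL2) f =
      inner ℂ (adjoint (formEmbedding c) f) (adjoint (formEmbedding c) f) := by
    rw [← h, formResolvent_apply, ContinuousLinearMap.adjoint_inner_right]
  have h3 : ‖(u : PlaneL2)‖ ≤ ‖adjoint (formEmbedding c) f‖ := by
    rw [← h, formResolvent_apply]
    simpa using (formEmbedding c).le_of_opNorm_le (norm_formEmbedding_le c) _
  rw [h1, inner_sub_right, h2, Complex.sub_re, sub_nonneg]
  have h4 := pow_le_pow_left₀ (norm_nonneg _) h3 2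
  rwa [← inner_self_eq_norm_sq (𝕜 := ℂ), ← inner_self_eq_norm_sq (𝕜 := ℂ)] at h4

theorem functionOfD_eq {c : Plane → ℝ} (hc : IsVelocity c) (f : ℝ → ℂ) :
    functionOfD c f = cfc (resolventSymbol f) (formResolvent (formEmbedding c)) := by
  rw [functionOfD, opFunction, invOneAdd_waveOp hc]
  rfl

/-! ### The Sobolev norm on the form domain -/

theorem inSobolev_one_formEmbedding {c : Plane → ℝ} (hc : IsVelocity c) (k : formDomain c) :
    InSobolev 1 (formEmbedding c k) :=
  inSobolev_one_of_distPartial fun i => ⟨_, distPartial_formEmbedding hc k i⟩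

/-- The form norm dominates the norm of `H¹`. -/
theorem exists_sobolevNormOne_formEmbedding_le {c : Plane → ℝ} (hc : IsVelocity c) :
    ∃ M, 0 ≤ M ∧ ∀ k : formDomain c, sobolevNormOne (formEmbedding c k) ≤ M * ‖k‖ := by
  obtain ⟨B, hB0, hB⟩ := hc.isStabilizing_inv.exists_bound
  refine ⟨Real.sqrt (1 + 2 * B ^ 2), Real.sqrt_nonneg _, fun k => ?_⟩
  have h1 : ∀ j, ‖(k : FieldSpace) j‖ ≤ ‖k‖ := fun j => PiLp.norm_apply_le (k : FieldSpace) j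
  have h2 : ∀ i, ‖weakPartial i (formEmbedding c k)‖ ^ 2 ≤ B ^ 2 * ‖k‖ ^ 2 := fun i => by
    rw [weakPartial_eq (distPartial_formEmbedding hc k i), ← mul_pow]
    refine pow_le_pow_left₀ (norm_nonneg _) ((hc.isStabilizing_inv.norm_mulL2_le hB _).trans ?_) 2
    exact mul_le_mul_of_nonneg_left (h1 _) hB0
  rw [sobolevNormOne, ← Real.sqrt_sq (norm_nonneg k), ← Real.sqrt_mul (by positivity),
    Fin.sum_univ_two]
  apply Real.sqrt_le_sqrt
  have h3 := pow_le_pow_left₀ (norm_nonneg _) (h1 none) 2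
  rw [formEmbedding_apply]
  have := h2 0
  have := h2 1
  rw [formEmbedding_apply] at *
  nlinarith

/-- The norm of an element of the form domain in terms of the weak derivatives. -/
theorem norm_formElement_le {c : Plane → ℝ} (hc : IsVelocity c) {B : ℝ} (hB : ∀ x, |c x| ≤ B)
    {u : PlaneL2} {w : Fin 2 → PlaneL2} (h : ∀ i, distPartial i (u : 𝓢'(Plane, ℂ)) = w i) :
    ‖formElement hc h‖ ≤ ‖u‖ + ∑ i, B * ‖w i‖ := by
  have hB0 : 0 ≤ B := (abs_nonneg _).trans (hB 0)
  change ‖(formElement hc h : FieldSpace)‖ ≤ _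
  have h0 : 0 ≤ ‖u‖ + ∑ i, B * ‖w i‖ := by positivity
  refine (sq_le_sq₀ (norm_nonneg _) h0).1 ?_
  rw [PiLp.norm_sq_eq_of_L2, Fintype.sum_option, Fin.sum_univ_two, Fin.sum_univ_two]
  simp only [formElement_none, formElement_some]
  have h1 := fun i => hc.isStabilizing.norm_mulL2_le hB (w i)
  have h2 := fun i => pow_le_pow_left₀ (norm_nonneg _) (h1 i) 2
  have h3 : ∀ i, 0 ≤ B * ‖w i‖ := fun i => by positivity
  nlinarith [h2 0, h2 1, mul_nonneg (norm_nonneg u) (h3 0), mul_nonneg (norm_nonneg u) (h3 1),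
    mul_nonneg (h3 0) (h3 1)]

end WaveOperator

/-! ### The source -/

section Source

open scoped SchwartzMap

/-- The classical partial derivatives of a square integrable `C¹` function are its distributional
derivatives, provided they are square integrable. -/
theorem distPartial_toLp {F : Plane → ℝ} (hF : ContDiff ℝ 1 F)
    (h : MemLp (fun x => (F x : ℂ)) 2 (volume : Measure Plane)) (i : Fin 2)
    (h' : MemLp (fun x => ((fderiv ℝ F x (planeBasis i) : ℝ) : ℂ)) 2 (volume : Measure Plane)) :
    distPartial i ((h.toLp _ : PlaneL2) : 𝓢'(Plane, ℂ)) = (h'.toLp _ : PlaneL2) := by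
  ext φ
  have hφ := φ.memLp 2 (volume : Measure Plane)
  have hφ' := (∂_{planeBasis i} φ).memLp 2 (volume : Measure Plane)
  have hd : ∀ x, HasFDerivAt (fun x => (F x : ℂ)) (Complex.ofRealCLM ∘L fderiv ℝ F x) x :=
    fun x => Complex.ofRealCLM.hasFDerivAt.comp x (hF.differentiable (by simp) x).hasFDerivAt
  have hfd : ∀ x, fderiv ℝ (fun x => (F x : ℂ)) x (planeBasis i) =
      ((fderiv ℝ F x (planeBasis i) : ℝ) : ℂ) := fun x => by rw [(hd x).fderiv]; rfl
  have key := integral_mul_fderiv_eq_neg_fderiv_mul_of_integrable (μ := (volume : Measure Plane))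
    (f := fun x => (F x : ℂ)) (g := φ) (v := planeBasis i)
    (by simp only [hfd]; exact h'.integrable_mul hφ)
    (by simp only [← SchwartzMap.lineDerivOp_apply_eq_fderiv]; exact h.integrable_mul hφ')
    (h.integrable_mul hφ) (fun x _ => (hd x).differentiableAt) (fun x _ => φ.differentiableAt)
  simp only [hfd, ← SchwartzMap.lineDerivOp_apply_eq_fderiv] at key
  rw [distPartial_apply, Lp.toTemperedDistribution_apply, Lp.toTemperedDistribution_apply]
  have e1 : ∫ x, (∂_{planeBasis i} φ) x • (h.toLp _ : PlaneL2) x =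
      ∫ x, (F x : ℂ) * (∂_{planeBasis i} φ) x := by
    refine integral_congr_ae ?_
    filter_upwards [h.coeFn_toLp] with x hx
    rw [hx, smul_eq_mul, mul_comm]
  have e2 : ∫ x, φ x • (h'.toLp _ : PlaneL2) x =
      ∫ x, ((fderiv ℝ F x (planeBasis i) : ℝ) : ℂ) * φ x := by
    refine integral_congr_ae ?_
    filter_upwards [h'.coeFn_toLp] with x hx
    rw [hx, smul_eq_mul, mul_comm]
  rw [e1, e2, key, neg_neg]

/-- Rescaling in the plane multiplies the norm of `L²` by the length scale. -/
theorem norm_toLp_comp_smul {F : Plane → ℝ} {μ : ℝ} (hμ : 0 < μ)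
    (h : MemLp (fun x : Plane => (F (μ⁻¹ • x) : ℂ)) 2 volume) :
    ‖(h.toLp _ : PlaneL2)‖ = μ * Real.sqrt (∫ y, F y ^ 2) := by
  have h0 : 0 ≤ μ * Real.sqrt (∫ y, F y ^ 2) := by positivity
  have hI : 0 ≤ ∫ y, F y ^ 2 := integral_nonneg fun y => sq_nonneg _
  refine (sq_eq_sq₀ (norm_nonneg _) h0).1 ?_
  rw [mul_pow, Real.sq_sqrt hI]
  have h1 : ((‖(h.toLp _ : PlaneL2)‖ ^ 2 : ℝ) : ℂ) =
      ((∫ x : Plane, F (μ⁻¹ • x) ^ 2 : ℝ) : ℂ) := by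
    have h2 := inner_self_eq_norm_sq_to_K (𝕜 := ℂ) (h.toLp _ : PlaneL2)
    rw [Complex.ofReal_pow, ← integral_complex_ofReal]
    refine h2.symm.trans ?_
    rw [L2.inner_def]
    refine integral_congr_ae ?_
    filter_upwards [h.coeFn_toLp] with x hx
    rw [hx]
    simp only [RCLike.inner_apply, Complex.conj_ofReal]
    push_cast
    ring
  have h3 : ‖(h.toLp _ : PlaneL2)‖ ^ 2 = ∫ x : Plane, F (μ⁻¹ • x) ^ 2 := by exact_mod_cast h1
  rw [h3, Measure.integral_comp_smul volume (fun y => F y ^ 2) μ⁻¹]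
  simp

theorem memLp_comp_smul_of_decay {F : Plane → ℝ} (hF : Continuous F) {C ρ : ℝ} (hρ : 1 < ρ)
    (hC : ∀ y, |F y| ≤ C * (1 + ‖y‖) ^ (-ρ)) {μ : ℝ} (hμ : 0 < μ) :
    MemLp (fun x : Plane => (F (μ⁻¹ • x) : ℂ)) 2 volume := by
  have hdom : Integrable (fun y : Plane => C ^ 2 * (1 + ‖y‖) ^ (-(2 * ρ))) volume :=
    (integrable_one_add_norm (by simp; linarith)).const_mul _
  have hint : Integrable (fun y : Plane => F y ^ 2) volume := by
    refine hdom.mono' (hF.pow 2).aestronglyMeasurable (Filter.Eventually.of_forall fun y => ?_)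
    have hp : (0 : ℝ) < 1 + ‖y‖ := by positivity
    have h2 : ((1 + ‖y‖) ^ (-ρ)) ^ 2 = (1 + ‖y‖) ^ (-(2 * ρ)) := by
      rw [← Real.rpow_natCast, ← Real.rpow_mul hp.le]
      congr 1
      push_cast
      ring
    rw [Real.norm_eq_abs, abs_pow, ← h2, ← mul_pow]
    exact pow_le_pow_left₀ (abs_nonneg _) (hC y) 2
  exact ((memLp_two_iff_integrable_sq
    (hF.comp (continuous_const_smul _)).aestronglyMeasurable).2
      (hint.comp_smul (inv_ne_zero hμ.ne'))).ofReal

/-- The gradient of the profile is square integrable after rescaling. -/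
theorem IsSpatialProfile.memLp_pderiv {V : Plane → ℝ} {ϰ : ℝ} (hV : IsSpatialProfile V ϰ)
    (hϰ : 1 < ϰ) {μ : ℝ} (hμ : 0 < μ) (i : Fin 2) :
    MemLp (fun x : Plane => ((fderiv ℝ V (μ⁻¹ • x) (planeBasis i) : ℝ) : ℂ)) 2 volume := by
  obtain ⟨C, hC⟩ := hV.decay 1
  refine memLp_comp_smul_of_decay (F := fun y => fderiv ℝ V y (planeBasis i)) (C := C)
    (ρ := 1 + ϰ) ?_ (by linarith) (fun y => ?_) hμ
  · exact (hV.smooth.continuous_fderiv (by simp)).clm_apply continuous_const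
  · have h1 := hC y
    rw [norm_iteratedFDeriv_one] at h1
    have h2 := (fderiv ℝ V y).le_opNorm (planeBasis i)
    rw [PiLp.norm_single, norm_one, mul_one] at h2
    refine (h2.trans h1).trans (le_of_eq ?_)
    congr 2
    push_cast
    ring

theorem distPartial_sourceL2 {V : Plane → ℝ} {ϰ : ℝ} (hV : IsSpatialProfile V ϰ)
    (hϰ : 1 < ϰ) {μ : ℝ} (hμ : 0 < μ) (i : Fin 2) :
    distPartial i (sourceL2 hV hϰ hμ : 𝓢'(Plane, ℂ)) =
      ((μ⁻¹ : ℂ) • ((hV.memLp_pderiv hϰ hμ i).toLp _ : PlaneL2) : PlaneL2) := by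
  have hfd : ∀ x, fderiv ℝ (fun x : Plane => V (μ⁻¹ • x)) x (planeBasis i) =
      μ⁻¹ * fderiv ℝ V (μ⁻¹ • x) (planeBasis i) := fun x => by
    have h1 : HasFDerivAt (fun x : Plane => μ⁻¹ • x)
        (μ⁻¹ • ContinuousLinearMap.id ℝ Plane) x := (hasFDerivAt_id x).const_smul μ⁻¹
    have h2 := (hV.smooth.differentiable (by simp) (μ⁻¹ • x)).hasFDerivAt.comp x h1
    have h3 : HasFDerivAt (fun x : Plane => V (μ⁻¹ • x)) _ x := h2
    rw [h3.fderiv]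
    simp
  have hm : MemLp (fun x : Plane =>
      ((fderiv ℝ (fun x : Plane => V (μ⁻¹ • x)) x (planeBasis i) : ℝ) : ℂ)) 2 volume := by
    have := (hV.memLp_pderiv hϰ hμ i).const_mul (μ⁻¹ : ℂ)
    simpa only [hfd, Complex.ofReal_mul, Complex.ofReal_inv] using this
  have hsm : ContDiff ℝ 1 fun x : Plane => V (μ⁻¹ • x) :=
    (hV.smooth.of_le (by simp)).comp (contDiff_const_smul _)
  rw [sourceL2, distPartial_toLp hsm (hV.memLp hϰ hμ) i hm]
  congr 1
  rw [← MemLp.toLp_const_smul]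
  refine MemLp.toLp_congr _ _ (Filter.Eventually.of_forall fun x => ?_)
  simp [hfd]

/-- The source has norm `O(μ)` in `L²` and, the plane being two-dimensional, norm `O(1)` in the
form domain. -/
theorem exists_norm_source_le {c : Plane → ℝ} (hc : IsVelocity c) {V : Plane → ℝ} {ϰ : ℝ}
    (hV : IsSpatialProfile V ϰ) (hϰ : 1 < ϰ) :
    ∃ B, 0 ≤ B ∧ ∀ (μ : ℝ) (hμ : 0 < μ), ‖sourceL2 hV hϰ hμ‖ ≤ μ * B ∧
      (μ < 1 → ∃ k : formDomain c, formEmbedding c k = sourceL2 hV hϰ hμ ∧ ‖k‖ ≤ B) := by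
  obtain ⟨M, hM0, hM⟩ := hc.isStabilizing.exists_bound
  set N : ℝ := Real.sqrt (∫ y, V y ^ 2)
  set N' : Fin 2 → ℝ := fun i => Real.sqrt (∫ y, fderiv ℝ V y (planeBasis i) ^ 2)
  have hN : 0 ≤ N := Real.sqrt_nonneg _
  have hN' : 0 ≤ ∑ i, M * N' i :=
    Finset.sum_nonneg fun i _ => mul_nonneg hM0 (Real.sqrt_nonneg _)
  refine ⟨N + ∑ i, M * N' i, by positivity, fun μ hμ => ?_⟩
  have h1 : ‖sourceL2 hV hϰ hμ‖ = μ * N := norm_toLp_comp_smul hμ (hV.memLp hϰ hμ)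
  refine ⟨h1.le.trans (mul_le_mul_of_nonneg_left (by linarith) hμ.le), fun hμ1 => ?_⟩
  refine ⟨formElement hc (distPartial_sourceL2 hV hϰ hμ), rfl, ?_⟩
  refine (norm_formElement_le hc hM _).trans (add_le_add ?_ (le_of_eq ?_))
  · rw [h1]
    exact mul_le_of_le_one_left hN hμ1.le
  · refine Finset.sum_congr rfl fun i _ => ?_
    rw [norm_smul, norm_toLp_comp_smul (F := fun y => fderiv ℝ V y (planeBasis i)) hμ
      (hV.memLp_pderiv hϰ hμ i), ← Complex.ofReal_inv, Complex.norm_real, Real.norm_eq_abs,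
      abs_of_pos (inv_pos.2 hμ), inv_mul_cancel_left₀ hμ.ne']

end Source

/-! ### The two components as functions of the resolvent -/

section Components

variable {c : Plane → ℝ} {g₀ : ℝ → ℝ} {ν : ℝ}

/-- The operator `(Re f)(D)`, as a function of the resolvent `J J*`. -/
abbrev reFunction (c : Plane → ℝ) (f : ℝ → ℂ) : PlaneL2 →L[ℂ] PlaneL2 :=
  cfc (resolventSymbol fun ξ => ((f ξ).re : ℂ)) (formResolvent (formEmbedding c))

theorem norm_ofReal_re_le (z : ℂ) : ‖((z.re : ℝ) : ℂ)‖ ≤ ‖z‖ := by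
  rw [Complex.norm_real]
  exact Complex.abs_re_le_norm z

theorem norm_reFunction_apply_le {f : ℝ → ℂ} {C : ℝ} (hC : ∀ ξ, ‖f ξ‖ ≤ C) (v : PlaneL2) :
    ‖reFunction c f v‖ ≤ C * ‖v‖ :=
  ContinuousLinearMap.le_of_opNorm_le _
    (norm_cfc_formResolvent_le fun ξ => (norm_ofReal_re_le _).trans (hC ξ)) v

theorem norm_reFunction_formEmbedding_le {f : ℝ → ℂ} (hf : IsSymbol f) {C : ℝ} (hC0 : 0 ≤ C)
    (hC : ∀ ξ, ‖f ξ‖ ≤ C * |ξ|) (k : formDomain c) :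
    ‖reFunction c f (formEmbedding c k)‖ ≤ C * ‖k‖ := by
  refine ContinuousLinearMap.le_of_opNorm_le _ (norm_cfc_formResolvent_comp_le
    (norm_formEmbedding_le c) hf.re hC0 fun ξ => ?_) k
  have h := pow_le_pow_left₀ (norm_nonneg _) ((norm_ofReal_re_le _).trans (hC ξ)) 2
  rw [mul_pow, sq_abs] at h
  nlinarith [sq_nonneg C]

/-- Real functions of `D` are bounded in `H¹` by the supremum of the symbol. -/
theorem sobolev_reFunction_le (hc : IsVelocity c) {M : ℝ} (hM0 : 0 ≤ M)
    (hM : ∀ k : formDomain c, sobolevNormOne (formEmbedding c k) ≤ M * ‖k‖) {f : ℝ → ℂ} {C : ℝ}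
    (hC : ∀ ξ, ‖f ξ‖ ≤ C) {k : formDomain c} {B : ℝ} (hk : ‖k‖ ≤ B) :
    InSobolev 1 (reFunction c f (formEmbedding c k)) ∧
      sobolevNormOne (reFunction c f (formEmbedding c k)) ≤ M * (C * B) := by
  have hC0 : 0 ≤ C := (norm_nonneg _).trans (hC 0)
  obtain ⟨k', hk', hk'n⟩ := exists_cfc_formResolvent_apply_eq (norm_formEmbedding_le c)
    (formEmbedding_injective c) (fun ξ => (norm_ofReal_re_le (f ξ)).trans (hC ξ)) k
  rw [reFunction, ← hk']
  refine ⟨inSobolev_one_formEmbedding hc k', (hM k').trans ?_⟩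
  exact mul_le_mul_of_nonneg_left
    (hk'n.trans (mul_le_mul_of_nonneg_left hk hC0)) hM0

theorem hasDerivWithinAt_reFunction {p : ℝ → ℝ → ℂ} {p' : ℝ → ℂ} {s : Set ℝ} {t₀ C : ℝ}
    (hp : ∀ t ∈ s, IsSymbol (p t)) (hp' : IsSymbol p') (ht₀ : t₀ ∈ s)
    (hC : ∀ t ∈ s, ∀ ξ, ‖p t ξ - p t₀ ξ - ((t - t₀ : ℝ) : ℂ) * p' ξ‖ ≤ C * (t - t₀) ^ 2)
    (v : PlaneL2) :
    HasDerivWithinAt (fun t => reFunction c (p t) v) (reFunction c p' v) s t₀ := by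
  have h := hasDerivWithinAt_cfc_formResolvent (norm_formEmbedding_le c) (s := s) (t₀ := t₀)
    (C := C) (fun t ht => (hp t ht).re) hp'.re ht₀ fun t ht ξ => by
      have := (norm_ofReal_re_le _).trans (hC t ht ξ)
      rw [Complex.sub_re, Complex.sub_re, Complex.re_ofReal_mul] at this
      simpa using this
  have hL := ((ContinuousLinearMap.apply ℂ PlaneL2 v).restrictScalars ℝ).hasFDerivAt
    (x := cfc (resolventSymbol fun ξ => ((p t₀ ξ).re : ℂ)) (formResolvent (formEmbedding c)))
  exact hL.comp_hasDerivWithinAt t₀ h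

/-- The symbol `exp(iξt) √(2π) g̃(ξ)` of the propagating component, for `g(τ) = λ g₀(λτ)`. -/
def propSymbol (g₀ : ℝ → ℝ) (lam t ξ : ℝ) : ℂ :=
  Complex.exp (Complex.I * ξ * t) * transSymbol g₀ (ξ / lam) 0

theorem norm_exp_I_mul (ξ t : ℝ) : ‖Complex.exp (Complex.I * ξ * t)‖ = 1 := by
  have : Complex.I * ξ * t = ((ξ * t : ℝ) : ℂ) * Complex.I := by push_cast; ring
  rw [this, Complex.norm_exp_ofReal_mul_I]

theorem IsSymbol.exp_mul {f : ℝ → ℂ} (hf : IsSymbol f) (t : ℝ) :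
    IsSymbol fun ξ => Complex.exp (Complex.I * ξ * t) * f ξ :=
  hf.mul_bounded (by fun_prop) fun ξ => (norm_exp_I_mul ξ t).le

theorem etaProp_eq (hc : IsVelocity c) {lam : ℝ} (hlam : 0 < lam)
    (hsym : IsSymbol fun η => transSymbol g₀ η 0) (v : PlaneL2) (t : ℝ) :
    etaProp c (scaledTime g₀ lam) v t = reFunction c (propSymbol g₀ lam t) v := by
  have h0 : ∀ ξ, fourierTilde (scaledTime g₀ lam) ξ =
      ((Real.sqrt (2 * Real.pi) : ℝ) : ℂ)⁻¹ * transSymbol g₀ (ξ / lam) 0 := fun ξ => by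
    have h1 := sqrt_two_pi_mul_fourierTilde (scaledTime g₀ lam) ξ
    rw [transSymbol_scaledTime g₀ hlam, mul_zero] at h1
    have h2 : ((Real.sqrt (2 * Real.pi) : ℝ) : ℂ) ≠ 0 :=
      Complex.ofReal_ne_zero.2 (by positivity)
    rw [← h1, inv_mul_cancel_left₀ h2]
  have hs : IsSymbol fun ξ =>
      Complex.exp (Complex.I * ξ * t) * fourierTilde (scaledTime g₀ lam) ξ := by
    simp only [h0]
    exact ((hsym.comp_div hlam).const_mul _).exp_mul t
  rw [etaProp, functionOfD_eq hc, realPart_cfc_formResolvent (norm_formEmbedding_le c) hs,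
    ← smul_apply, ← cfc_formResolvent_const_mul (norm_formEmbedding_le c) hs.re,
    reFunction]
  congr 3
  ext ξ
  rw [← Complex.ofReal_mul, ← Complex.re_ofReal_mul, propSymbol, mul_left_comm,
    sqrt_two_pi_mul_fourierTilde, transSymbol_scaledTime g₀ hlam, mul_zero]

theorem etaTrans_eq (hc : IsVelocity c) {lam : ℝ} (hlam : 0 < lam) {t : ℝ}
    (hsym : IsSymbol fun η => transSymbol g₀ η (lam * t)) (v : PlaneL2) :
    etaTrans c (scaledTime g₀ lam) v t =
      -reFunction c (fun ξ => transSymbol g₀ (ξ / lam) (lam * t)) v := by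
  simp only [etaTrans, functionOfD_eq hc, transSymbol_scaledTime g₀ hlam]
  rw [realPart_cfc_formResolvent (norm_formEmbedding_le c) (hsym.comp_div hlam)]

end Components

end

theorem mainTheorem6
    (c : Plane → ℝ) (hc : IsVelocity c)
    (V : Plane → ℝ) (ϰ : ℝ) (hϰ : 1 < ϰ) (hV : IsSpatialProfile V ϰ)
    (g₀ : ℝ → ℝ) (ν : ℝ) (hν : 0 < ν) (hg : IsTimeProfile g₀ ν) :
    ((∀ u : PlaneL2, u ∈ (waveOp c).domain ↔ InSobolev 2 u) ∧
      IsSelfAdjoint (waveOp c) ∧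
      ∀ u : (waveOp c).domain, 0 ≤ (inner ℂ (u : PlaneL2) (waveOp c u)).re) ∧
    ∃ C μ₀ : ℝ, 0 < μ₀ ∧ ∀ (μ : ℝ) (hμ : 0 < μ), μ < μ₀ → ∀ lam : ℝ, 0 < lam →
      ∀ t : ℝ, 0 ≤ t →
        (InSobolev 1 (etaProp c (scaledTime g₀ lam) (sourceL2 hV hϰ hμ) t) ∧
          sobolevNormOne (etaProp c (scaledTime g₀ lam) (sourceL2 hV hϰ hμ) t) ≤ C) ∧
        (DifferentiableWithinAt ℝ
            (etaProp c (scaledTime g₀ lam) (sourceL2 hV hϰ hμ)) (Ici 0) t ∧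
          ‖derivWithin (etaProp c (scaledTime g₀ lam) (sourceL2 hV hϰ hμ)) (Ici 0) t‖ ≤ C) ∧
        (InSobolev 1 (etaTrans c (scaledTime g₀ lam) (sourceL2 hV hϰ hμ) t) ∧
          sobolevNormOne (etaTrans c (scaledTime g₀ lam) (sourceL2 hV hϰ hμ) t)
            ≤ C * Real.exp (-ν * lam * t)) ∧
        (DifferentiableWithinAt ℝ
            (etaTrans c (scaledTime g₀ lam) (sourceL2 hV hϰ hμ)) (Ici 0) t ∧
          ‖derivWithin (etaTrans c (scaledTime g₀ lam) (sourceL2 hV hϰ hμ)) (Ici 0) t‖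
            ≤ C * ((omegaRatio c lam μ)⁻¹ * Real.exp (-ν * lam * t))) := by
  refine ⟨⟨mem_waveOp_domain_iff hc, isSelfAdjoint_waveOp hc, waveOp_nonneg hc⟩, ?_⟩
  obtain ⟨M, hM0, hM⟩ := exists_sobolevNormOne_formEmbedding_le hc
  obtain ⟨B, hB0, hB⟩ := exists_norm_source_le hc hV hϰ
  obtain ⟨C₀, h₀⟩ := hg.exists_isExpDecaying 0
  obtain ⟨C₁, h₁⟩ := hg.exists_isExpDecaying 1
  obtain ⟨C₂, h₂⟩ := hg.exists_isExpDecaying 2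
  have d₀ := hg.hasDerivWithinAt 0
  have d₁ := hg.hasDerivWithinAt 1
  simp only [zero_add, Nat.reduceAdd, iteratedDerivWithin_zero] at h₀ d₀ d₁
  set g₁ := iteratedDerivWithin 1 g₀ (Ici 0)
  set g₂ := iteratedDerivWithin 2 g₀ (Ici 0)
  obtain ⟨Q, hQ0, hQ⟩ := h₀.exists_norm_transSymbol_zero_le h₁ h₂ hν d₀ d₁ hg.zero
  have hA : 0 ≤ C₀ / ν := div_nonneg h₀.nonneg hν.le
  have hA' : 0 ≤ C₁ / ν := div_nonneg h₁.nonneg hν.le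
  have hc0 := hc.pos 0
  have sym₀ : ∀ {s : ℝ}, 0 ≤ s → IsSymbol fun η => transSymbol g₀ η s :=
    fun hs => h₀.isSymbol_transSymbol h₁ hν d₀ hs
  have sym₁ : ∀ {s : ℝ}, 0 ≤ s → IsSymbol fun η => transSymbol g₁ η s :=
    fun hs => h₁.isSymbol_transSymbol h₂ hν d₁ hs
  have T1 : 0 ≤ M * (C₀ / ν * B) := by positivity
  have T2 : 0 ≤ C₀ / ν * B := by positivity
  have T3 : 0 ≤ C₁ / ν * B * c 0 := by positivity
  refine ⟨M * (C₀ / ν * B) + C₀ / ν * B + C₁ / ν * B * c 0, 1, one_pos, ?_⟩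
  intro μ hμ hμ1 lam hlam t ht
  -- `k` represents the source in the form domain, with `‖k‖` bounded uniformly in `μ < 1`.
  obtain ⟨hvnorm, hk⟩ := hB μ hμ
  obtain ⟨k, hkv, hkB⟩ := hk hμ1
  set v := sourceL2 hV hϰ hμ
  have hlt : 0 ≤ lam * t := by positivity
  have hexp : Real.exp (-ν * (lam * t)) = Real.exp (-ν * lam * t) := by rw [mul_assoc]
  have hP : etaProp c (scaledTime g₀ lam) v = fun t => reFunction c (propSymbol g₀ lam t) v :=
    funext fun t => etaProp_eq hc hlam (sym₀ le_rfl) v t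
  have hT : ∀ t ∈ Ici (0 : ℝ), etaTrans c (scaledTime g₀ lam) v t =
      -reFunction c (fun ξ => transSymbol g₀ (ξ / lam) (lam * t)) v := fun t ht =>
    etaTrans_eq hc hlam (sym₀ (mul_nonneg hlam.le ht)) v
  have hU := uniqueDiffOn_Ici (0 : ℝ) t ht
  have hm0 : ∀ ξ, ‖transSymbol g₀ (ξ / lam) 0‖ ≤ C₀ / ν := fun ξ => by
    simpa using h₀.norm_transSymbol_le hν le_rfl (ξ / lam)
  refine ⟨?_, ?_, ?_, ?_⟩
  · rw [hP, ← hkv]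
    have := sobolev_reFunction_le hc hM0 hM (f := propSymbol g₀ lam t) (C := C₀ / ν)
      (fun ξ => by rw [propSymbol, norm_mul, norm_exp_I_mul, one_mul]; exact hm0 ξ) hkB
    exact ⟨this.1, by linarith [this.2]⟩
  · -- As `g₀ 0 = 0`, an integration by parts turns `i ξ` times the symbol into the symbol of `g'`.
    have hI : ∀ ξ : ℝ, Complex.I * ξ * transSymbol g₀ (ξ / lam) 0 =
        lam * transSymbol g₁ (ξ / lam) 0 := fun ξ => by
      have h := h₀.I_mul_transSymbol h₁ hν d₀ le_rfl (ξ / lam)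
      rw [hg.zero, Complex.ofReal_zero, zero_add] at h
      rw [← h]
      push_cast
      have : (lam : ℂ) ≠ 0 := Complex.ofReal_ne_zero.2 hlam.ne'
      field_simp
    have hs' : IsSymbol fun ξ : ℝ => Complex.exp (Complex.I * ξ * t) *
        (Complex.I * ξ * transSymbol g₀ (ξ / lam) 0) := by
      simp only [hI]
      exact (((sym₁ le_rfl).comp_div hlam).const_mul _).exp_mul t
    have hderiv : HasDerivWithinAt (fun t => reFunction c (propSymbol g₀ lam t) v)
        (reFunction c (fun ξ : ℝ => Complex.exp (Complex.I * ξ * t) *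
          (Complex.I * ξ * transSymbol g₀ (ξ / lam) 0)) v) (Ici 0) t := by
      refine hasDerivWithinAt_reFunction (p := propSymbol g₀ lam) (C := 3 * (lam ^ 2 * Q))
        (fun t _ => ((sym₀ le_rfl).comp_div hlam).exp_mul t) hs' ht (fun s _ ξ => ?_) v
      have e : propSymbol g₀ lam s ξ - propSymbol g₀ lam t ξ - ((s - t : ℝ) : ℂ) *
          (Complex.exp (Complex.I * ξ * t) * (Complex.I * ξ * transSymbol g₀ (ξ / lam) 0)) =
          (Complex.exp (Complex.I * ξ * s) - Complex.exp (Complex.I * ξ * t) -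
            ((s - t : ℝ) : ℂ) * (Complex.I * ξ * Complex.exp (Complex.I * ξ * t))) *
            transSymbol g₀ (ξ / lam) 0 := by
        simp only [propSymbol]
        ring
      rw [e, norm_mul]
      have h5 := mul_le_mul_of_nonneg_right (norm_exp_taylor_le ξ t s)
        (norm_nonneg (transSymbol g₀ (ξ / lam) 0))
      have h6 : ξ ^ 2 * ‖transSymbol g₀ (ξ / lam) 0‖ ≤ lam ^ 2 * Q := by
        have h7 : ξ ^ 2 = lam ^ 2 * (ξ / lam) ^ 2 := by field_simp
        rw [h7, mul_assoc]
        refine mul_le_mul_of_nonneg_left (le_trans ?_ (hQ (ξ / lam))) (by positivity)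
        exact mul_le_mul_of_nonneg_right (by linarith) (norm_nonneg _)
      nlinarith [sq_nonneg (s - t)]
    rw [hP]
    refine ⟨hderiv.differentiableWithinAt, ?_⟩
    rw [hderiv.derivWithin hU, ← hkv]
    have := norm_reFunction_formEmbedding_le hs' hA (fun ξ => by
      rw [norm_mul, norm_exp_I_mul, one_mul, norm_mul, norm_mul, Complex.norm_I, one_mul,
        Complex.norm_real, Real.norm_eq_abs, mul_comm]
      exact mul_le_mul_of_nonneg_right (hm0 ξ) (abs_nonneg ξ)) k
    have := mul_le_mul_of_nonneg_left hkB hA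
    linarith
  · rw [hT t ht, ← hkv, ← map_neg, ← map_neg]
    have := sobolev_reFunction_le hc hM0 hM (k := -k) (B := B)
      (fun ξ => h₀.norm_transSymbol_le hν hlt (ξ / lam)) (by rw [norm_neg]; exact hkB)
    refine ⟨this.1, this.2.trans ?_⟩
    rw [hexp]
    calc _ = M * (C₀ / ν * B) * Real.exp (-ν * lam * t) := by ring
      _ ≤ _ := mul_le_mul_of_nonneg_right (by linarith) (Real.exp_nonneg _)
  · have hderiv : HasDerivWithinAt
        (fun t => reFunction c (fun ξ => transSymbol g₀ (ξ / lam) (lam * t)) v)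
        (reFunction c (fun ξ => lam * transSymbol g₁ (ξ / lam) (lam * t)) v) (Ici 0) t := by
      refine hasDerivWithinAt_reFunction (p := fun t ξ => transSymbol g₀ (ξ / lam) (lam * t))
        (s := Ici 0) (C := C₂ / ν * lam ^ 2)
        (fun t ht => (sym₀ (mul_nonneg hlam.le ht)).comp_div hlam)
        (((sym₁ hlt).comp_div hlam).const_mul _) ht (fun s hs ξ => ?_) v
      have := h₀.norm_transSymbol_taylor_le h₁ h₂ hν d₀ d₁ hlt (mul_nonneg hlam.le hs) (ξ / lam)
      rw [← mul_sub, mul_pow] at this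
      rw [← mul_assoc, ← Complex.ofReal_mul, mul_comm (s - t), mul_assoc (C₂ / ν)]
      exact this
    have hderiv' := HasDerivWithinAt.congr hderiv.neg hT (hT t ht)
    refine ⟨hderiv'.differentiableWithinAt, ?_⟩
    rw [hderiv'.derivWithin hU, norm_neg]
    refine (norm_reFunction_apply_le (C := lam * (C₁ / ν * Real.exp (-ν * lam * t)))
      (fun ξ => ?_) v).trans ?_
    · rw [norm_mul, Complex.norm_real, Real.norm_eq_abs, abs_of_pos hlam, ← hexp]
      exact mul_le_mul_of_nonneg_left (h₁.norm_transSymbol_le hν hlt _) hlam.le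
    -- The factor `λ` of the derivative and the norm `O(μ)` of the source give `λ μ = c(0)/ω`.
    · have hE := Real.exp_nonneg (-ν * lam * t)
      have hω : (omegaRatio c lam μ)⁻¹ = lam * μ / c 0 := by rw [omegaRatio, inv_div]
      rw [hω]
      calc _ ≤ lam * (C₁ / ν * Real.exp (-ν * lam * t)) * (μ * B) := by gcongr
        _ = C₁ / ν * B * c 0 * (lam * μ / c 0 * Real.exp (-ν * lam * t)) := by
          field_simp
        _ ≤ _ := by
          refine mul_le_mul_of_nonneg_right (by linarith) ?_
          positivity
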